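/- **Conventions.** For $0<q<\infty$ and an interval $(a,c)$ let $\|g\|_{q,(a,c)}=\big(\int_a^c |g(u)|^q\,du\big)^{1/q}\in[0,\infty]$. For nonnegative functions $g,h$ on $(0,\infty)$, $g\approx h$ means $c\,h(t)\le g(t)\le C\,h(t)$ for all $t>0$ with constants $c,C>0$. A Lebesgue measurable $b:(0,\infty)\to(0,\infty)$ is slowly varying, $b\in SV$, if for every $\varepsilon>0$ the function $t^{\varepsilon}b(t)$ is equivalent ($\approx$) to a positive non-decreasing function and $t^{-\varepsilon}b(t)$ is equivalent to a positive non-increasing function on $(0,\infty)$. We write $b\in SV_{0,q}$ if $b\in SV$ and $\|u^{-1/q}b(u)\|_{q,(1,\infty)}<\infty$. For quasi-normed spaces $A_0,A_1$ inside a common vector space, $K(t,f;A_0,A_1)=\inf\{\|f_0\|_{A_0}+t\|f_1\|_{A_1}: f=f_0+f_1,\ f_j\in A_j\}$, and $(A_0,A_1)_{\theta,q;b}$ is the space of all $f\in A_0+A_1$ for which $\|f\|_{\theta,q;b}=\|t^{-\theta-1/q}b(t)K(t,f;A_0,A_1)\|_{q,(0,\infty)}$ is finite. Let $(\Omega,\mu)$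 be a $\sigma$-finite measure space, and for a real measurable function $f$ on $\Omega$ (functions equal $\mu$-a.e. being identified) let $f^*(t)=\inf\{\lambda\ge 0:\mu\{|f|>\lambda\}\le t\}$. The generalized gamma space $\Gamma(r,q,p;b,w)$ consists of all $f$ for which $$\|f\|_{\Gamma(r,q,p;b,w)}=\Big\|t^{-1/q}b(t)\,\big\|\tau^{1/p-1/r}w(\tau)f^*(\tau)\big\|_{r,(0,t)}\Big\|_{q,(0,\infty)}$$ is finite. **Theorem.** Let $0<q_0,q_1<\infty$, $q_0\ne q_1$, $0<q,p,r<\infty$, $0<\theta<1$, $b_0\in SV_{0,q_0}$, $b_1\in SV_{0,q_1}$ and $b,w\in SV$. For $t>0$ and $\epsilon>0$ put $$\rho(t)=\frac{\|u^{-1/q_0}b_0(u)\|_{q_0,(t,\infty)}}{\|u^{-1/q_1}b_1(u)\|_{q_1,(t,\infty)}},\qquad \rho_\epsilon(t)=\frac{\|u^{-1/q_0}b_0(u)\|_{q_0,(t,\infty)}^{1+\epsilon}}{\|u^{-1/q_1}b_1(u)\|_{q_1,(t,\infty)}}.$$ Assume that for some $\epsilon>0$ the function $\rho_\epsilon$ is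 equivalent to a non-decreasing function on $(0,\infty)$, and that $\rho$ is non-decreasing on $(0,\infty)$ with $\lim_{t\to0^+}\rho(t)=0$ and $\lim_{t\to\infty}\rho(t)=\infty$. Put $$\tilde b(t)=\rho(t)^{1-\theta}\,b(\rho(t))\,b_1(t)^{q_1/q}\Big(\int_t^\infty b_1(u)^{q_1}\frac{du}{u}\Big)^{1/q_1-1/q},\qquad t>0.$$ Then, with equivalent quasi-norms, $$\big(\Gamma(r,q_0,p;b_0,w),\,\Gamma(r,q_1,p;b_1,w)\big)_{\theta,q;b}=\Gamma(r,q,p;\tilde b,w).$$ Moreover, $\tilde b\in SV_{0,q}$ whenever $b\circ\rho$ is Lebesgue measurable (in particular if $b$ is a Borel function); if $b\circ\rho$ is not measurable, the integral in $\|\cdot\|_{\Gamma(r,q,p;\tilde b,w)}$ is read as a lower integral. -/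

import Mathlib

noncomputable section

namespace GenGamma

open MeasureTheory Set
open scoped ENNReal

/-- The `L^q`-quasi-norm `(∫_s g(u)^q du)^{1/q}` (Lebesgue measure on `s ⊆ ℝ`, `0 < q < ∞`) of a
nonnegative function `g`, with values in `[0, ∞]`. -/
def lqNorm (q : ℝ) (s : Set ℝ) (g : ℝ → ℝ≥0∞) : ℝ≥0∞ :=
  (∫⁻ u in s, g u ^ q) ^ (1 / q)

/-- `f ≈ g` on `(0, ∞)`: two-sided estimate with positive constants. -/
def Equivalent (f g : ℝ → ℝ) : Prop :=
  ∃ c > 0, ∃ C > 0, ∀ t : ℝ, 0 < t → c * g t ≤ f t ∧ f t ≤ C * g t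

/-- Slowly varying functions on `(0, ∞)` (the class `SV`): positive, Lebesgue measurable, and for
every `ε > 0`, `t^ε b(t)` is equivalent to a positive non-decreasing function and `t^{-ε} b(t)` to
a positive non-increasing one. Values off `(0, ∞)` are irrelevant. -/
structure IsSV (b : ℝ → ℝ) : Prop where
  pos : ∀ t, 0 < t → 0 < b t
  aemeasurable : AEMeasurable b (volume.restrict (Ioi 0))
  equiv_mono : ∀ ε : ℝ, 0 < ε → ∃ g : ℝ → ℝ, (∀ t, 0 < t → 0 < g t) ∧ MonotoneOn g (Ioi 0) ∧
    Equivalent (fun t => t ^ ε * b t) g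
  equiv_anti : ∀ ε : ℝ, 0 < ε → ∃ g : ℝ → ℝ, (∀ t, 0 < t → 0 < g t) ∧ AntitoneOn g (Ioi 0) ∧
    Equivalent (fun t => t ^ (-ε) * b t) g

/-- `‖u^{-1/q} b(u)‖_{q,(t,∞)}` in `[0, ∞]`. -/
def tailENorm (q : ℝ) (b : ℝ → ℝ) (t : ℝ) : ℝ≥0∞ :=
  lqNorm q (Ioi t) (fun u => ENNReal.ofReal (u ^ (-(1 / q)) * b u))

/-- The class `SV_{0,q}`: `b ∈ SV` with `‖u^{-1/q} b(u)‖_{q,(1,∞)} < ∞`. -/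
structure IsSV0 (q : ℝ) (b : ℝ → ℝ) : Prop where
  isSV : IsSV b
  tail_lt_top : tailENorm q b 1 < ∞

/-- `‖u^{-1/q} b(u)‖_{q,(t,∞)}` as a real number (it is finite for `t > 0` and `b ∈ SV_{0,q}`). -/
def tailNorm (q : ℝ) (b : ℝ → ℝ) (t : ℝ) : ℝ :=
  (tailENorm q b t).toReal

/-- `ρ(t) = ‖u^{-1/q₀} b₀(u)‖_{q₀,(t,∞)} / ‖u^{-1/q₁} b₁(u)‖_{q₁,(t,∞)}`. -/
def rho (q₀ q₁ : ℝ) (b₀ b₁ : ℝ → ℝ) (t : ℝ) : ℝ :=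
  tailNorm q₀ b₀ t / tailNorm q₁ b₁ t

/-- `ρ_ε(t) = ‖u^{-1/q₀} b₀(u)‖_{q₀,(t,∞)}^{1+ε} / ‖u^{-1/q₁} b₁(u)‖_{q₁,(t,∞)}`. -/
def rhoEps (q₀ q₁ : ℝ) (b₀ b₁ : ℝ → ℝ) (ε t : ℝ) : ℝ :=
  tailNorm q₀ b₀ t ^ (1 + ε) / tailNorm q₁ b₁ t

/-- For some `ε > 0`, the function `ρ_ε` is equivalent to a non-decreasing function. -/
def RhoCondition (q₀ q₁ : ℝ) (b₀ b₁ : ℝ → ℝ) : Prop :=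
  ∃ ε : ℝ, 0 < ε ∧ ∃ g : ℝ → ℝ, MonotoneOn g (Ioi 0) ∧ Equivalent (rhoEps q₀ q₁ b₀ b₁ ε) g

/-- `b̃(t) = ρ(t)^{1-θ} b(ρ(t)) b₁(t)^{q₁/q} (∫_t^∞ b₁(u)^{q₁} du/u)^{1/q₁-1/q}`. -/
def bTilde (q₀ q₁ q θ : ℝ) (b₀ b₁ b : ℝ → ℝ) (t : ℝ) : ℝ :=
  rho q₀ q₁ b₀ b₁ t ^ (1 - θ) * b (rho q₀ q₁ b₀ b₁ t) * b₁ t ^ (q₁ / q) *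
    (∫ u in Ioi t, b₁ u ^ q₁ / u) ^ (1 / q₁ - 1 / q)

section Interpolation

variable {V : Type*} [AddCommGroup V]

/-- The set of vectors of finite quasi-norm. A quasi-normed space inside `V` is given by its
quasi-norm, extended by `∞` to the rest of `V`. -/
def finiteSet (N : V → ℝ≥0∞) : Set V :=
  {f | N f < ∞}

/-- The sum `A₀ + A₁` of two quasi-normed spaces inside `V`. -/
def sumSet (N₀ N₁ : V → ℝ≥0∞) : Set V :=
  {f | ∃ f₀ ∈ finiteSet N₀, ∃ f₁ ∈ finiteSet N₁, f = f₀ + f₁}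

/-- The `K`-functional
`K(t, f; A₀, A₁) = inf {‖f₀‖ + t ‖f₁‖ : f₀ ∈ A₀, f₁ ∈ A₁, f = f₀ + f₁}`. -/
def kFunctional (N₀ N₁ : V → ℝ≥0∞) (t : ℝ) (f : V) : ℝ≥0∞ :=
  ⨅ (f₀ : V) (_ : f₀ ∈ finiteSet N₀) (f₁ : V) (_ : f₁ ∈ finiteSet N₁) (_ : f = f₀ + f₁),
    N₀ f₀ + ENNReal.ofReal t * N₁ f₁

/-- The quasi-norm `‖t^{-θ-1/q} b(t) K(t, f; A₀, A₁)‖_{q,(0,∞)}`. -/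
def interpNorm (N₀ N₁ : V → ℝ≥0∞) (θ q : ℝ) (b : ℝ → ℝ) (f : V) : ℝ≥0∞ :=
  lqNorm q (Ioi 0)
    (fun t => ENNReal.ofReal (t ^ (-θ - 1 / q) * b t) * kFunctional N₀ N₁ t f)

/-- The `K`-interpolation space `(A₀, A₁)_{θ,q;b}`. -/
def interpSpace (N₀ N₁ : V → ℝ≥0∞) (θ q : ℝ) (b : ℝ → ℝ) : Set V :=
  {f | f ∈ sumSet N₀ N₁ ∧ interpNorm N₀ N₁ θ q b f < ∞}

end Interpolation

section Gamma

variable {Ω : Type*} [MeasurableSpace Ω] {μ : Measure Ω}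

/-- The non-increasing rearrangement `f^*(t) = inf {λ ≥ 0 : μ{|f| > λ} ≤ t}`. -/
def rearrangement (f : Ω →ₘ[μ] ℝ) (t : ℝ) : ℝ≥0∞ :=
  sInf {l : ℝ≥0∞ | μ {x | l < ‖f x‖ₑ} ≤ ENNReal.ofReal t}

/-- The quasi-norm
`‖ t^{-1/q} b(t) ‖τ^{1/p-1/r} w(τ) f^*(τ)‖_{r,(0,t)} ‖_{q,(0,∞)}` of `Γ(r,q,p;b,w)`. -/
def gammaNorm (r q p : ℝ) (b w : ℝ → ℝ) (f : Ω →ₘ[μ] ℝ) : ℝ≥0∞ :=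
  lqNorm q (Ioi 0) (fun t => ENNReal.ofReal (t ^ (-(1 / q)) * b t) *
    lqNorm r (Ioo 0 t) (fun τ => ENNReal.ofReal (τ ^ (1 / p - 1 / r) * w τ) * rearrangement f τ))

variable (μ) in
/-- The generalized gamma space `Γ(r,q,p;b,w)` of (classes of) real measurable functions. -/
def gammaSpace (r q p : ℝ) (b w : ℝ → ℝ) : Set (Ω →ₘ[μ] ℝ) :=
  finiteSet (gammaNorm r q p b w)

end Gamma

end GenGamma

end

/-!
Write `A_i(t) = ‖u^{-1/q_i} b_i(u)‖_{q_i,(t,∞)}`, so that `ρ = A₀ / A₁`, and let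
`F(t) = ‖τ^{1/p-1/r} w(τ) f^*(τ)‖_{r,(0,t)}`, a non-decreasing function of `t`. Cutting `f` at the
height `f^*(t)` is a nearly optimal decomposition for the `K`-functional at `ρ(t)`, which gives
`K(ρ(t), f) ≈ ‖u^{-1/q₀} b₀ F‖_{q₀,(0,t)} + ρ(t) ‖u^{-1/q₁} b₁ F‖_{q₁,(t,∞)}`.

Choose points `t_k`, `k ∈ ℤ`, along which `A₁` decreases by a fixed large factor `M`. The
condition on `ρ_ε` and the identity `ρ^{1+ε} = ρ_ε A₁^{-ε}` make `ρ(t_k)` grow at least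
geometrically, and `A₀` being non-increasing makes it grow at most geometrically. Since a slowly
varying factor loses to any power, the discrete Hardy inequality reduces the interpolation
quasi-norm to the `ℓ^q` quasi-norm of `U(t_k) F(t_k)`, where `U = ρ^{-θ} b(ρ) A₀`. On the other
side `b̃ = U A₁^{-q₁/q} b₁^{q₁/q}`, and `∫ b₁^{q₁} du/u` over `(t_k, t_{k+1}]` equals
`(1 - M^{-q₁}) A₁(t_k)^{q₁}`, so the quasi-norm of `Γ(r,q,p;b̃,w)` reduces to the same `ℓ^q`
quasi-norm.

On a single grid interval the functions involved are comparable to constants or to `b₁`, so the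
estimates there hold for lower integrals and `b ∘ ρ` need not be measurable.
-/

noncomputable section

namespace GenGamma

open Filter MeasureTheory Set
open scoped ENNReal NNReal

/-! ### Slow variation -/

/-- The real numbers `x` and `y` are positive and agree up to the factor `C`. -/
structure Comparable (C x y : ℝ) : Prop where
  pos_left : 0 < x
  pos_right : 0 < y
  le : x ≤ C * y
  ge : y ≤ C * x

namespace Comparable

variable {C D x y x' y' : ℝ}

theorem refl (hx : 0 < x) : Comparable 1 x x :=
  ⟨hx, hx, (one_mul x).ge, (one_mul x).ge⟩

theorem symm (h : Comparable C x y) : Comparable C y x :=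
  ⟨h.pos_right, h.pos_left, h.ge, h.le⟩

theorem of_le (hx : 0 < x) (hxy : x ≤ y) : Comparable (y / x) x y where
  pos_left := hx
  pos_right := hx.trans_le hxy
  le := hxy.trans (le_mul_of_one_le_left (hx.le.trans hxy) ((one_le_div hx).2 hxy))
  ge := (div_mul_cancel₀ y hx.ne').ge

theorem const_pos (h : Comparable C x y) : 0 < C :=
  pos_of_mul_pos_left (h.pos_left.trans_le h.le) h.pos_right.le

theorem one_le (h : Comparable C x y) : 1 ≤ C := by
  by_contra! hC
  nlinarith [h.pos_left, h.pos_right, h.le, h.ge]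

theorem mono (h : Comparable C x y) (hCD : C ≤ D) : Comparable D x y where
  pos_left := h.pos_left
  pos_right := h.pos_right
  le := h.le.trans (mul_le_mul_of_nonneg_right hCD h.pos_right.le)
  ge := h.ge.trans (mul_le_mul_of_nonneg_right hCD h.pos_left.le)

theorem mul (h : Comparable C x y) (h' : Comparable D x' y') :
    Comparable (C * D) (x * x') (y * y') where
  pos_left := mul_pos h.pos_left h'.pos_left
  pos_right := mul_pos h.pos_right h'.pos_right
  le := by
    rw [mul_mul_mul_comm]
    exact mul_le_mul h.le h'.le h'.pos_left.le (h.pos_left.le.trans h.le)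
  ge := by
    rw [mul_mul_mul_comm]
    exact mul_le_mul h.ge h'.ge h'.pos_right.le (h.pos_right.le.trans h.ge)

theorem inv (h : Comparable C x y) : Comparable C x⁻¹ y⁻¹ where
  pos_left := inv_pos.2 h.pos_left
  pos_right := inv_pos.2 h.pos_right
  le := by
    rw [← div_eq_mul_inv, le_div_iff₀ h.pos_right, inv_mul_le_iff₀ h.pos_left, mul_comm]
    exact h.ge
  ge := by
    rw [← div_eq_mul_inv, le_div_iff₀ h.pos_left, inv_mul_le_iff₀ h.pos_right, mul_comm]
    exact h.le

theorem rpow_of_nonneg (h : Comparable C x y) {e : ℝ} (he : 0 ≤ e) :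
    Comparable (C ^ e) (x ^ e) (y ^ e) where
  pos_left := Real.rpow_pos_of_pos h.pos_left e
  pos_right := Real.rpow_pos_of_pos h.pos_right e
  le := by
    rw [← Real.mul_rpow h.const_pos.le h.pos_right.le]
    exact Real.rpow_le_rpow h.pos_left.le h.le he
  ge := by
    rw [← Real.mul_rpow h.const_pos.le h.pos_left.le]
    exact Real.rpow_le_rpow h.pos_right.le h.ge he

theorem rpow (h : Comparable C x y) (e : ℝ) : Comparable (C ^ |e|) (x ^ e) (y ^ e) := by
  rcases le_total 0 e with he | he
  · rw [abs_of_nonneg he]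
    exact h.rpow_of_nonneg he
  · rw [abs_of_nonpos he]
    simpa only [Real.inv_rpow h.pos_left.le, Real.inv_rpow h.pos_right.le,
      Real.rpow_neg h.pos_left.le, Real.rpow_neg h.pos_right.le, inv_inv] using
      h.inv.rpow_of_nonneg (neg_nonneg.2 he)

end Comparable

/-- Slow variation in quantitative two-sided form: for each `ε > 0`, moving the argument by a
factor `D` changes `b` by at most a constant times `D ^ ε` (Potter bounds). -/
def Potter (b : ℝ → ℝ) : Prop :=
  ∀ ε : ℝ, 0 < ε → ∃ C : ℝ, ∀ D x y : ℝ, Comparable D x y → Comparable (C * D ^ ε) (b x) (b y)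

namespace Potter

variable {b b' : ℝ → ℝ}

theorem pos (hb : Potter b) {t : ℝ} (ht : 0 < t) : 0 < b t :=
  let ⟨_, hC⟩ := hb 1 one_pos
  (hC 1 t t (.refl ht)).pos_left

theorem of_le (hb : ∀ ε : ℝ, 0 < ε → ∃ C : ℝ, ∀ s t : ℝ, 0 < s → s ≤ t →
    Comparable (C * (t / s) ^ ε) (b s) (b t)) : Potter b := by
  intro ε hε
  obtain ⟨C, hC⟩ := hb ε hε
  have ordered {D x y : ℝ} (hxy : x ≤ y) (hD : Comparable D x y) :
      Comparable (C * D ^ ε) (b x) (b y) := by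
    have hx := hD.pos_left
    have hquot : 0 < y / x := div_pos hD.pos_right hx
    have hCpos : 0 < C :=
      pos_of_mul_pos_left (hC x y hx hxy).const_pos (Real.rpow_pos_of_pos hquot ε).le
    refine (hC x y hx hxy).mono ?_
    gcongr
    exact (div_le_iff₀ hx).2 hD.ge
  refine ⟨C, fun D x y hD => ?_⟩
  rcases le_total x y with hxy | hyx
  · exact ordered hxy hD
  · exact (ordered hyx hD.symm).symm

theorem mul (hb : Potter b) (hb' : Potter b') : Potter (fun t => b t * b' t) := by
  intro ε hε
  obtain ⟨C, hC⟩ := hb (ε / 2) (half_pos hε)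
  obtain ⟨C', hC'⟩ := hb' (ε / 2) (half_pos hε)
  refine ⟨C * C', fun D x y hD => ?_⟩
  have hsplit : C * C' * D ^ ε = C * D ^ (ε / 2) * (C' * D ^ (ε / 2)) := by
    rw [mul_mul_mul_comm, ← Real.rpow_add hD.const_pos, add_halves]
  rw [hsplit]
  exact (hC D x y hD).mul (hC' D x y hD)

theorem rpow (hb : Potter b) (e : ℝ) : Potter (fun t => b t ^ e) := by
  intro ε hε
  have he : 0 < |e| + 1 := by positivity
  obtain ⟨C, hC⟩ := hb (ε / (|e| + 1)) (by positivity)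
  have hCpos : 0 < C := by simpa using (hC 1 1 1 (.refl one_pos)).const_pos
  refine ⟨C ^ |e|, fun D x y hD => ((hC D x y hD).rpow e).mono ?_⟩
  have hDpos := hD.const_pos
  rw [Real.mul_rpow hCpos.le (by positivity), ← Real.rpow_mul hDpos.le]
  gcongr
  · exact hD.one_le
  · rw [div_mul_eq_mul_div, div_le_iff₀ he]
    nlinarith [abs_nonneg e]

theorem comp (hb : Potter b) (hb' : Potter b') : Potter (fun t => b (b' t)) := by
  intro ε hε
  obtain ⟨C, hC⟩ := hb 1 one_pos
  obtain ⟨C', hC'⟩ := hb' ε hε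
  refine ⟨C * C', fun D x y hD => ?_⟩
  simpa only [Real.rpow_one, mul_assoc] using hC _ _ _ (hC' D x y hD)

theorem of_le_comparable (hb : Potter b) {ε : ℝ} (hε : 0 < ε) : ∃ C : ℝ, ∀ s t : ℝ, 0 < s →
    s ≤ t → Comparable (C * (t / s) ^ ε) (b s) (b t) :=
  let ⟨C, hC⟩ := hb ε hε
  ⟨C, fun s t hs hst => hC (t / s) s t (.of_le hs hst)⟩

theorem congr (hb : Potter b) (h : EqOn b b' (Ioi 0)) : Potter b' :=
  fun ε hε =>
    let ⟨C, hC⟩ := hb ε hε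
    ⟨C, fun D x y hD => by simpa only [h hD.pos_left, h hD.pos_right] using hC D x y hD⟩

theorem exists_geometric_le (hb : Potter b) {a : ℝ} (ha : 0 < a) :
    ∃ C γ : ℝ≥0, γ < 1 ∧ ∀ (n : ℕ) (s t : ℝ), 0 < s → 2 ^ n * s ≤ t →
      s ^ a * b s ≤ C * γ ^ n * (t ^ a * b t) ∧
        t ^ (-a) * b t ≤ C * γ ^ n * (s ^ (-a) * b s) := by
  obtain ⟨C, hC⟩ := hb.of_le_comparable (half_pos ha)
  have hCpos : 0 < C := by simpa using (hC 1 1 one_pos le_rfl).const_pos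
  refine ⟨C.toNNReal, (1 / 2) ^ (a / 2), NNReal.rpow_lt_one (by norm_num) (half_pos ha),
    fun n s t hs hst => ?_⟩
  have hle : s ≤ t := (le_mul_of_one_le_left hs.le (one_le_pow₀ one_le_two)).trans hst
  have ht := hs.trans_le hle
  have hbs := hb.pos hs
  have hbt := hb.pos ht
  obtain ⟨-, -, hst_le, hst_ge⟩ := hC s t hs hle
  have hratio : (s / t) ^ (a / 2) ≤ ((1 / 2) ^ (a / 2)) ^ n := by
    rw [← Real.rpow_mul_natCast (by norm_num), mul_comm, Real.rpow_natCast_mul (by norm_num)]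
    refine Real.rpow_le_rpow (div_nonneg hs.le ht.le) ?_ (half_pos ha).le
    rw [one_div, inv_pow, div_le_iff₀ ht, ← div_eq_inv_mul, le_div_iff₀ (by positivity), mul_comm]
    exact hst
  have hscale : (t / s) ^ (a / 2) * (s / t) ^ a = (s / t) ^ (a / 2) := by
    rw [← inv_div s t, Real.inv_rpow (div_nonneg hs.le ht.le), ← Real.rpow_neg (by positivity),
      ← Real.rpow_add (div_pos hs ht)]
    ring_nf
  rw [Real.coe_toNNReal _ hCpos.le, NNReal.coe_rpow, NNReal.coe_div, NNReal.coe_one,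
    NNReal.coe_ofNat]
  constructor
  · calc s ^ a * b s ≤ s ^ a * (C * (t / s) ^ (a / 2) * b t) := by gcongr
      _ = C * ((t / s) ^ (a / 2) * (s / t) ^ a) * (t ^ a * b t) := by
        rw [Real.div_rpow hs.le ht.le a]
        field_simp
      _ ≤ C * ((1 / 2) ^ (a / 2)) ^ n * (t ^ a * b t) := by
        rw [hscale]
        gcongr
  · calc t ^ (-a) * b t ≤ t ^ (-a) * (C * (t / s) ^ (a / 2) * b s) := by gcongr
      _ = C * ((t / s) ^ (a / 2) * (s / t) ^ a) * (s ^ (-a) * b s) := by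
        rw [Real.div_rpow hs.le ht.le a, Real.rpow_neg hs.le, Real.rpow_neg ht.le]
        field_simp
      _ ≤ C * ((1 / 2) ^ (a / 2)) ^ n * (s ^ (-a) * b s) := by
        rw [hscale]
        gcongr

end Potter

/-- Values at comparable points are comparable, with a constant that depends on the former one
only. -/
def Doubling (v : ℝ → ℝ) : Prop :=
  ∀ D : ℝ, ∃ C : ℝ, ∀ x y : ℝ, Comparable D x y → Comparable C (v x) (v y)

theorem Potter.doubling {b : ℝ → ℝ} (hb : Potter b) : Doubling b := fun D =>
  let ⟨C, hC⟩ := hb 1 one_pos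
  ⟨C * D ^ (1 : ℝ), hC D⟩

namespace Doubling

variable {v : ℝ → ℝ}

theorem pos (hv : Doubling v) {t : ℝ} (ht : 0 < t) : 0 < v t :=
  let ⟨_, hC⟩ := hv 1
  (hC t t (.refl ht)).pos_left

theorem rpow_mul (hv : Doubling v) (e : ℝ) : Doubling (fun t => t ^ e * v t) := fun D =>
  let ⟨C, hC⟩ := hv D
  ⟨D ^ |e| * C, fun x y hD => (hD.rpow e).mul (hC x y hD)⟩

end Doubling

/-- `h` is increasing on `(0, ∞)` up to a constant factor. -/
def AlmostMonotone (h : ℝ → ℝ) : Prop :=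
  ∃ C : ℝ, ∀ s t : ℝ, 0 < s → s ≤ t → h s ≤ C * h t

/-- `h` is decreasing on `(0, ∞)` up to a constant factor. -/
def AlmostAntitone (h : ℝ → ℝ) : Prop :=
  ∃ C : ℝ, ∀ s t : ℝ, 0 < s → s ≤ t → h t ≤ C * h s

theorem Equivalent.almostMonotone {h g : ℝ → ℝ} (hhg : Equivalent h g)
    (hg : MonotoneOn g (Ioi 0)) : AlmostMonotone h := by
  obtain ⟨c, hc, C, hC, hhg⟩ := hhg
  refine ⟨C * c⁻¹, fun s t hs hst => ?_⟩
  have ht := hs.trans_le hst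
  calc h s ≤ C * g s := (hhg s hs).2
    _ ≤ C * g t := by gcongr; exact hg hs ht hst
    _ ≤ C * (c⁻¹ * h t) := by gcongr; exact (le_inv_mul_iff₀ hc).2 (hhg t ht).1
    _ = _ := (mul_assoc _ _ _).symm

theorem Equivalent.almostAntitone {h g : ℝ → ℝ} (hhg : Equivalent h g)
    (hg : AntitoneOn g (Ioi 0)) : AlmostAntitone h := by
  obtain ⟨c, hc, C, hC, hhg⟩ := hhg
  refine ⟨C * c⁻¹, fun s t hs hst => ?_⟩
  have ht := hs.trans_le hst
  calc h t ≤ C * g t := (hhg t ht).2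
    _ ≤ C * g s := by gcongr; exact hg hs ht hst
    _ ≤ C * (c⁻¹ * h s) := by gcongr; exact (le_inv_mul_iff₀ hc).2 (hhg s hs).1
    _ = _ := (mul_assoc _ _ _).symm

theorem AlmostMonotone.exists_equivalent {h : ℝ → ℝ} (hpos : ∀ t, 0 < t → 0 < h t)
    (hh : AlmostMonotone h) :
    ∃ g : ℝ → ℝ, (∀ t, 0 < t → 0 < g t) ∧ MonotoneOn g (Ioi 0) ∧ Equivalent h g := by
  obtain ⟨C, hC⟩ := hh
  have hCpos : 0 < C := pos_of_mul_pos_left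
    ((hpos 1 one_pos).trans_le (hC 1 1 one_pos le_rfl)) (hpos 1 one_pos).le
  have upper (t : ℝ) : C * h t ∈ upperBounds (h '' Ioc 0 t) := by
    rintro _ ⟨s, hs, rfl⟩
    exact hC s t hs.1 hs.2
  have le_sup (t : ℝ) (ht : 0 < t) : h t ≤ sSup (h '' Ioc 0 t) :=
    le_csSup ⟨_, upper t⟩ (mem_image_of_mem h ⟨ht, le_rfl⟩)
  have nonempty (t : ℝ) (ht : 0 < t) : (h '' Ioc 0 t).Nonempty := (nonempty_Ioc.2 ht).image h
  refine ⟨fun t => sSup (h '' Ioc 0 t), fun t ht => (hpos t ht).trans_le (le_sup t ht),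
    fun s hs t _ hst => csSup_le_csSup ⟨_, upper t⟩ (nonempty s hs)
      (image_mono (Ioc_subset_Ioc_right hst)),
    C⁻¹, inv_pos.2 hCpos, 1, one_pos, fun t ht => ⟨?_, ?_⟩⟩
  · exact (inv_mul_le_iff₀ hCpos).2 (csSup_le (nonempty t ht) (upper t))
  · simpa only [one_mul] using le_sup t ht

theorem AlmostAntitone.inv {h : ℝ → ℝ} (hpos : ∀ t, 0 < t → 0 < h t) (hh : AlmostAntitone h) :
    AlmostMonotone (fun t => (h t)⁻¹) := by
  obtain ⟨C, hC⟩ := hh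
  refine ⟨C, fun s t hs hst => ?_⟩
  rw [← div_eq_mul_inv, le_div_iff₀ (hpos t (hs.trans_le hst)), inv_mul_le_iff₀ (hpos s hs),
    mul_comm]
  exact hC s t hs hst

theorem AlmostAntitone.exists_equivalent {h : ℝ → ℝ} (hpos : ∀ t, 0 < t → 0 < h t)
    (hh : AlmostAntitone h) :
    ∃ g : ℝ → ℝ, (∀ t, 0 < t → 0 < g t) ∧ AntitoneOn g (Ioi 0) ∧ Equivalent h g := by
  obtain ⟨g, hg, hg_mono, c, hc, C, hC, hhg⟩ :=
    (hh.inv hpos).exists_equivalent fun t ht => inv_pos.2 (hpos t ht)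
  refine ⟨fun t => (g t)⁻¹, fun t ht => inv_pos.2 (hg t ht),
    fun s hs t ht hst => inv_anti₀ (hg s hs) (hg_mono hs ht hst),
    C⁻¹, inv_pos.2 hC, c⁻¹, inv_pos.2 hc, fun t ht => ⟨?_, ?_⟩⟩
  · rw [← mul_inv, inv_le_comm₀ (mul_pos hC (hg t ht)) (hpos t ht)]
    exact (hhg t ht).2
  · rw [← mul_inv, le_inv_comm₀ (hpos t ht) (mul_pos hc (hg t ht))]
    exact (hhg t ht).1

theorem rpow_mul_le_mul_rpow_mul_iff {s t : ℝ} (hs : 0 < s) (ht : 0 < t) (ε C x y : ℝ) :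
    s ^ ε * x ≤ C * (t ^ ε * y) ↔ x ≤ C * (t / s) ^ ε * y := by
  have hsε : 0 < s ^ ε := Real.rpow_pos_of_pos hs ε
  have : C * (t / s) ^ ε * y = (s ^ ε)⁻¹ * (C * (t ^ ε * y)) := by
    rw [Real.div_rpow ht.le hs.le]; ring
  rw [this, le_inv_mul_iff₀ hsε]

theorem rpow_neg_mul_le_mul_rpow_neg_mul_iff {s t : ℝ} (hs : 0 < s) (ht : 0 < t) (ε C x y : ℝ) :
    t ^ (-ε) * x ≤ C * (s ^ (-ε) * y) ↔ x ≤ C * (t / s) ^ ε * y := by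
  rw [rpow_mul_le_mul_rpow_mul_iff ht hs, Real.rpow_neg (div_pos hs ht).le,
    ← Real.inv_rpow (div_pos hs ht).le, inv_div]

theorem isSV_iff_potter {b : ℝ → ℝ} :
    IsSV b ↔ Potter b ∧ AEMeasurable b (volume.restrict (Ioi 0)) := by
  constructor
  · refine fun hb => ⟨Potter.of_le fun ε hε => ?_, hb.aemeasurable⟩
    obtain ⟨g, -, hg, hbg⟩ := hb.equiv_mono ε hε
    obtain ⟨g', -, hg', hbg'⟩ := hb.equiv_anti ε hε
    obtain ⟨C, hC⟩ := hbg.almostMonotone hg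
    obtain ⟨C', hC'⟩ := hbg'.almostAntitone hg'
    refine ⟨max C C', fun s t hs hst => ?_⟩
    have ht := hs.trans_le hst
    have hbs := hb.pos s hs
    have hbt := hb.pos t ht
    refine ⟨hbs, hbt, ?_, ?_⟩
    · refine ((rpow_mul_le_mul_rpow_mul_iff hs ht ..).1 (hC s t hs hst)).trans ?_
      gcongr
      exact le_max_left ..
    · refine ((rpow_neg_mul_le_mul_rpow_neg_mul_iff hs ht ..).1 (hC' s t hs hst)).trans ?_
      gcongr
      exact le_max_right ..
  · rintro ⟨hb, hb_meas⟩
    refine ⟨fun t ht => hb.pos ht, hb_meas,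
      fun ε hε => AlmostMonotone.exists_equivalent (fun t ht => ?_) ?_,
      fun ε hε => AlmostAntitone.exists_equivalent (fun t ht => ?_) ?_⟩
    · exact mul_pos (Real.rpow_pos_of_pos ht _) (hb.pos ht)
    · obtain ⟨C, hC⟩ := hb.of_le_comparable hε
      exact ⟨C, fun s t hs hst =>
        (rpow_mul_le_mul_rpow_mul_iff hs (hs.trans_le hst) ..).2 (hC s t hs hst).le⟩
    · exact mul_pos (Real.rpow_pos_of_pos ht _) (hb.pos ht)
    · obtain ⟨C, hC⟩ := hb.of_le_comparable hε
      exact ⟨C, fun s t hs hst =>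
        (rpow_neg_mul_le_mul_rpow_neg_mul_iff hs (hs.trans_le hst) ..).2 (hC s t hs hst).ge⟩

theorem IsSV.potter {b : ℝ → ℝ} (hb : IsSV b) : Potter b :=
  (isSV_iff_potter.1 hb).1

/-! ### The measure `du / u` -/

theorem exists_add_rpow_le {e : ℝ} (he : 0 ≤ e) :
    ∃ C : ℝ≥0, ∀ x y : ℝ≥0∞, (x + y) ^ e ≤ C * (x ^ e + y ^ e) := by
  refine ⟨(ENNReal.LpAddConst (ENNReal.ofReal e)⁻¹).toNNReal, fun x y => ?_⟩
  rw [ENNReal.coe_toNNReal (ENNReal.LpAddConst_lt_top _).ne]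
  exact ENNReal.rpow_add_le_mul_rpow_add_rpow' x y he

theorem Comparable.ofReal_le {C x y : ℝ} (h : Comparable C x y) :
    ENNReal.ofReal x ≤ C.toNNReal * ENNReal.ofReal y := by
  rw [← ENNReal.ofReal, ← ENNReal.ofReal_mul h.const_pos.le]
  exact ENNReal.ofReal_le_ofReal h.le

/-- The measure `du / u` on `(0, ∞)`, extended by zero to the negative axis. -/
def logMeasure : Measure ℝ :=
  volume.withDensity fun u => ENNReal.ofReal u⁻¹

theorem setLIntegral_logMeasure {s : Set ℝ} (hs : MeasurableSet s) (G : ℝ → ℝ≥0∞) :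
    ∫⁻ u in s, G u ∂logMeasure = ∫⁻ u in s, ENNReal.ofReal u⁻¹ * G u := by
  rw [logMeasure, restrict_withDensity hs, lintegral_withDensity_eq_lintegral_mul_non_measurable _
    measurable_inv.ennreal_ofReal (ae_of_all _ fun _ => ENNReal.ofReal_lt_top)]
  rfl

theorem logMeasure_absolutelyContinuous : logMeasure ≪ volume :=
  withDensity_absolutelyContinuous _ _

theorem measurePreserving_mul_logMeasure {c : ℝ} (hc : 0 < c) :
    MeasurePreserving (c * ·) logMeasure logMeasure := by
  refine ⟨measurable_const_mul c, Measure.ext fun s hs => ?_⟩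
  have hs' : MeasurableSet ((c * ·) ⁻¹' s) := measurable_const_mul c hs
  rw [Measure.map_apply (measurable_const_mul c) hs, logMeasure, withDensity_apply _ hs',
    withDensity_apply _ hs]
  calc ∫⁻ u in (c * ·) ⁻¹' s, ENNReal.ofReal u⁻¹
      = ∫⁻ u in (c * ·) ⁻¹' s, ENNReal.ofReal |c| * ENNReal.ofReal (c * u)⁻¹ := by
        refine lintegral_congr fun u => ?_
        rw [← ENNReal.ofReal_mul (abs_nonneg c), abs_of_pos hc, mul_inv,
          mul_inv_cancel_left₀ hc.ne']
    _ = ENNReal.ofReal |c| * ∫⁻ u in s, ENNReal.ofReal u⁻¹ ∂volume.map (c * ·) := by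
        rw [lintegral_const_mul' _ _ ENNReal.ofReal_ne_top,
          (measurableEmbedding_mulLeft₀ hc.ne').restrict_map,
          (measurableEmbedding_mulLeft₀ hc.ne').lintegral_map]
    _ = ∫⁻ u in s, ENNReal.ofReal u⁻¹ := by
        conv_rhs => rw [← Real.smul_map_volume_mul_left hc.ne', Measure.restrict_smul,
          lintegral_smul_measure, smul_eq_mul]

/-- The quasi-norm `(∫_s G(u)^q du/u)^{1/q}`. -/
def logNorm (q : ℝ) (s : Set ℝ) (G : ℝ → ℝ≥0∞) : ℝ≥0∞ :=
  (∫⁻ u in s, G u ^ q ∂logMeasure) ^ (1 / q)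

section LogNorm

variable {q : ℝ} {s t : Set ℝ} {G H : ℝ → ℝ≥0∞}

theorem lqNorm_eq_logNorm (hq : 0 < q) (hs : MeasurableSet s) (hs₀ : s ⊆ Ioi 0) (a : ℝ)
    (v : ℝ → ℝ) (G : ℝ → ℝ≥0∞) :
    lqNorm q s (fun u => ENNReal.ofReal (u ^ (a - 1 / q) * v u) * G u) =
      logNorm q s fun u => ENNReal.ofReal (u ^ a * v u) * G u := by
  rw [lqNorm, logNorm, setLIntegral_logMeasure hs]
  congr 1
  refine setLIntegral_congr_fun hs fun u hu => ?_
  have hu₀ : 0 < u := hs₀ hu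
  have hsplit : u ^ (a - 1 / q) * v u = u ^ (-(1 / q)) * (u ^ a * v u) := by
    rw [← mul_assoc, ← Real.rpow_add hu₀, neg_add_eq_sub]
  have hpow : ENNReal.ofReal (u ^ (-(1 / q))) ^ q = ENNReal.ofReal u⁻¹ := by
    rw [ENNReal.ofReal_rpow_of_pos (Real.rpow_pos_of_pos hu₀ _), ← Real.rpow_mul hu₀.le,
      neg_mul, one_div_mul_cancel hq.ne', Real.rpow_neg_one]
  rw [hsplit, ENNReal.ofReal_mul (by positivity), mul_assoc,
    ENNReal.mul_rpow_of_nonneg _ _ hq.le, hpow]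

theorem logNorm_rpow_self (hq : 0 < q) (s : Set ℝ) (G : ℝ → ℝ≥0∞) :
    logNorm q s G ^ q = ∫⁻ u in s, G u ^ q ∂logMeasure := by
  rw [logNorm, ← ENNReal.rpow_mul, one_div_mul_cancel hq.ne', ENNReal.rpow_one]

theorem logNorm_mono (hq : 0 < q) (hs : MeasurableSet s) (hGH : ∀ u ∈ s, G u ≤ H u) :
    logNorm q s G ≤ logNorm q s H := by
  unfold logNorm
  gcongr 1
  exact setLIntegral_mono' hs fun u hu => by gcongr; exact hGH u hu

theorem logNorm_mono_set (hq : 0 < q) (hst : s ⊆ t) : logNorm q s G ≤ logNorm q t G := by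
  unfold logNorm
  gcongr

theorem logNorm_const_mul (hq : 0 < q) {c : ℝ≥0∞} (hc : c ≠ ∞) (s : Set ℝ) (G : ℝ → ℝ≥0∞) :
    logNorm q s (fun u => c * G u) = c * logNorm q s G := by
  simp only [logNorm, ENNReal.mul_rpow_of_nonneg _ _ hq.le]
  rw [lintegral_const_mul' _ _ (ENNReal.rpow_ne_top_of_nonneg hq.le hc),
    ENNReal.mul_rpow_of_nonneg _ _ (one_div_nonneg.2 hq.le), ← ENNReal.rpow_mul,
    mul_one_div_cancel hq.ne', ENNReal.rpow_one]

theorem const_mul_logNorm_le (hq : 0 < q) (c : ℝ≥0∞) (s : Set ℝ) (G : ℝ → ℝ≥0∞) :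
    c * logNorm q s G ≤ logNorm q s (fun u => c * G u) := by
  rw [← ENNReal.rpow_le_rpow_iff hq, ENNReal.mul_rpow_of_nonneg _ _ hq.le,
    logNorm_rpow_self hq, logNorm_rpow_self hq]
  simpa only [ENNReal.mul_rpow_of_nonneg _ _ hq.le] using lintegral_const_mul_le _ _

theorem logNorm_mul_le_logNorm_mul (hq : 0 < q) (hs : MeasurableSet s) {c : ℝ≥0∞}
    (v : ℝ → ℝ≥0∞) {F : ℝ → ℝ≥0∞} (hF : ∀ u ∈ s, c ≤ F u) :
    logNorm q s v * c ≤ logNorm q s fun u => v u * F u := by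
  rw [mul_comm]
  refine (const_mul_logNorm_le hq _ _ _).trans (logNorm_mono hq hs fun u hu => ?_)
  rw [mul_comm]
  gcongr
  exact hF u hu

theorem logNorm_Ioc_mul_le (hq : 0 < q) {v F : ℝ → ℝ≥0∞} (hF : Monotone F) {c : ℝ≥0∞}
    (hc : c ≠ 0) {a b : ℝ} (hv : logNorm q (Ioc a b) v ≤ c) :
    logNorm q (Ioc a b) (fun u => v u * F u) ≤ c * F b := by
  rcases eq_or_ne (F b) ∞ with hFb | hFb
  · simp [hFb, ENNReal.mul_top, hc]
  calc logNorm q (Ioc a b) (fun u => v u * F u)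
      ≤ logNorm q (Ioc a b) fun u => F b * v u := by
        refine logNorm_mono hq measurableSet_Ioc fun u hu => ?_
        rw [mul_comm]
        gcongr
        exact hF hu.2
    _ ≤ c * F b := by
        rw [logNorm_const_mul hq hFb, mul_comm]
        gcongr

theorem exists_logNorm_union_le (hq : 0 < q) : ∃ C : ℝ≥0, ∀ (s t : Set ℝ) (G : ℝ → ℝ≥0∞),
    logNorm q (s ∪ t) G ≤ C * (logNorm q s G + logNorm q t G) := by
  obtain ⟨C, hC⟩ := exists_add_rpow_le (one_div_nonneg.2 hq.le)
  refine ⟨C, fun s t G => le_trans ?_ (hC _ _)⟩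
  unfold logNorm
  gcongr
  exact lintegral_union_le _ s t

theorem exists_logNorm_add_le (hq : 0 < q) : ∃ C : ℝ≥0, ∀ (s : Set ℝ) (G H : ℝ → ℝ≥0∞),
    AEMeasurable G (logMeasure.restrict s) →
    logNorm q s (fun u => G u + H u) ≤ C * (logNorm q s G + logNorm q s H) := by
  obtain ⟨C, hC⟩ := exists_add_rpow_le hq.le
  obtain ⟨C', hC'⟩ := exists_add_rpow_le (one_div_nonneg.2 hq.le)
  refine ⟨C ^ (1 / q) * C', fun s G H hG => ?_⟩
  calc logNorm q s (fun u => G u + H u)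
      ≤ (∫⁻ u in s, C * (G u ^ q + H u ^ q) ∂logMeasure) ^ (1 / q) := by
        unfold logNorm
        gcongr
        exact hC _ _
    _ = C ^ (1 / q) *
        (∫⁻ u in s, G u ^ q ∂logMeasure + ∫⁻ u in s, H u ^ q ∂logMeasure) ^ (1 / q) := by
        rw [lintegral_const_mul' _ _ ENNReal.coe_ne_top, lintegral_add_left' (hG.pow_const q),
          ENNReal.mul_rpow_of_nonneg _ _ (one_div_nonneg.2 hq.le)]
    _ ≤ C ^ (1 / q) * (C' * (logNorm q s G + logNorm q s H)) := by
        gcongr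
        exact hC' _ _
    _ = _ := by
        rw [ENNReal.coe_mul, ENNReal.coe_rpow_of_nonneg _ (one_div_nonneg.2 hq.le), mul_assoc]

theorem logNorm_comp_mul {c : ℝ} (hc : 0 < c) (q : ℝ) (s : Set ℝ) (G : ℝ → ℝ≥0∞) :
    logNorm q ((c * ·) ⁻¹' s) (fun u => G (c * u)) = logNorm q s G :=
  congrArg (· ^ (1 / q)) ((measurePreserving_mul_logMeasure hc).setLIntegral_comp_preimage_emb
    (measurableEmbedding_mulLeft₀ hc.ne') (fun u => G u ^ q) s)

theorem logNorm_le_of_comparable {q C : ℝ} (hq : 0 < q) {s : Set ℝ} (hs : MeasurableSet s)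
    {v v' : ℝ → ℝ} (h : ∀ u ∈ s, Comparable C (v u) (v' u)) :
    logNorm q s (fun u => ENNReal.ofReal (v u)) ≤
      C.toNNReal * logNorm q s fun u => ENNReal.ofReal (v' u) := by
  rw [← logNorm_const_mul hq ENNReal.coe_ne_top]
  exact logNorm_mono hq hs fun u hu => (h u hu).ofReal_le

end LogNorm

theorem logNorm_Ioc_rpow_lt_top {q a : ℝ} (hq : 0 < q) (ha : 0 < a) :
    logNorm q (Ioc 0 1) (fun u => ENNReal.ofReal (u ^ a)) < ∞ := by
  refine ENNReal.rpow_lt_top_of_nonneg (one_div_nonneg.2 hq.le) ?_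
  have hint : IntegrableOn (fun u : ℝ => u ^ (a * q - 1)) (Ioc 0 1) :=
    (intervalIntegral.intervalIntegrable_rpow' (by nlinarith)).1
  rw [setLIntegral_logMeasure measurableSet_Ioc]
  refine ne_of_eq_of_ne (setLIntegral_congr_fun measurableSet_Ioc fun u hu => ?_)
    hint.lintegral_lt_top.ne
  rw [ENNReal.ofReal_rpow_of_pos (Real.rpow_pos_of_pos hu.1 a),
    ← ENNReal.ofReal_mul (inv_nonneg.2 hu.1.le), ← Real.rpow_mul hu.1.le,
    Real.rpow_sub_one hu.1.ne', div_eq_inv_mul]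

theorem Potter.exists_logNorm_Ioc_le {v : ℝ → ℝ} (hv : Potter v) {q a : ℝ} (hq : 0 < q)
    (ha : 0 < a) : ∃ C : ℝ≥0, ∀ t : ℝ, 0 < t →
      logNorm q (Ioc 0 t) (fun u => ENNReal.ofReal (u ^ a * v u)) ≤
        C * ENNReal.ofReal (t ^ a * v t) := by
  obtain ⟨C, hC⟩ := hv.of_le_comparable (half_pos ha)
  have hCpos : 0 < C := by simpa using (hC 1 1 one_pos le_rfl).const_pos
  have hI := logNorm_Ioc_rpow_lt_top hq (half_pos ha)
  set I := logNorm q (Ioc 0 1) (fun u => ENNReal.ofReal (u ^ (a / 2)))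
  refine ⟨C.toNNReal * I.toNNReal, fun t ht => ?_⟩
  have pointwise (u : ℝ) (hu : u ∈ Ioc (0 : ℝ) 1) : ENNReal.ofReal ((t * u) ^ a * v (t * u)) ≤
      C.toNNReal * ENNReal.ofReal (t ^ a * v t) * ENNReal.ofReal (u ^ (a / 2)) := by
    have hvt := hv.pos ht
    have hu₀ := hu.1
    rw [← ENNReal.ofReal, ← ENNReal.ofReal_mul hCpos.le, ← ENNReal.ofReal_mul (by positivity)]
    refine ENNReal.ofReal_le_ofReal ?_
    have hle := (hC (t * u) t (by positivity) (mul_le_of_le_one_right ht.le hu.2)).le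
    rw [div_mul_cancel_left₀ ht.ne', Real.inv_rpow hu₀.le] at hle
    calc (t * u) ^ a * v (t * u)
        ≤ t ^ a * u ^ a * (C * (u ^ (a / 2))⁻¹ * v t) := by
          rw [Real.mul_rpow ht.le hu₀.le]
          gcongr
      _ = C * (t ^ a * v t) * (u ^ a * (u ^ (a / 2))⁻¹) := by ring
      _ = C * (t ^ a * v t) * u ^ (a / 2) := by
          rw [← Real.rpow_neg hu₀.le, ← Real.rpow_add hu₀]; ring_nf
  calc logNorm q (Ioc 0 t) (fun u => ENNReal.ofReal (u ^ a * v u))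
      = logNorm q (Ioc 0 1) (fun u => ENNReal.ofReal ((t * u) ^ a * v (t * u))) := by
        rw [← logNorm_comp_mul ht, preimage_const_mul_Ioc₀ _ _ ht, zero_div, div_self ht.ne']
    _ ≤ C.toNNReal * ENNReal.ofReal (t ^ a * v t) * I := by
        rw [← logNorm_const_mul hq (by finiteness)]
        exact logNorm_mono hq measurableSet_Ioc pointwise
    _ = _ := by rw [ENNReal.coe_mul, ENNReal.coe_toNNReal hI.ne]; ring

theorem one_half_le_logMeasure_Ioo {s : ℝ} (hs : 0 < s) : 1 / 2 ≤ logMeasure (Ioo s (2 * s)) := by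
  calc (1 / 2 : ℝ≥0∞) = ENNReal.ofReal (2 * s)⁻¹ * volume (Ioo s (2 * s)) := by
        rw [Real.volume_Ioo, ← ENNReal.ofReal_mul (by positivity), two_mul, add_sub_cancel_right,
          ← two_mul, mul_inv, inv_mul_cancel_right₀ hs.ne', ENNReal.ofReal_inv_of_pos two_pos,
          ENNReal.ofReal_ofNat, one_div]
    _ = ∫⁻ _ in Ioo s (2 * s), ENNReal.ofReal (2 * s)⁻¹ := (setLIntegral_const _ _).symm
    _ ≤ ∫⁻ u in Ioo s (2 * s), ENNReal.ofReal u⁻¹ :=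
        setLIntegral_mono' measurableSet_Ioo fun u hu =>
          ENNReal.ofReal_le_ofReal (inv_anti₀ (hs.trans hu.1) hu.2.le)
    _ = logMeasure (Ioo s (2 * s)) := (withDensity_apply _ measurableSet_Ioo).symm

theorem Doubling.exists_le_logNorm_Ioo {v : ℝ → ℝ} (hv : Doubling v) {q : ℝ} (hq : 0 < q) :
    ∃ C : ℝ≥0, ∀ s t : ℝ, 0 < s → t ∈ Icc s (2 * s) →
      ENNReal.ofReal (v t) ≤
        C * logNorm q (Ioo s (2 * s)) (fun u => ENNReal.ofReal (v u)) := by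
  obtain ⟨C, hC⟩ := hv 2
  refine ⟨2 ^ (1 / q) * C.toNNReal, fun s t hs ht => ?_⟩
  have comparable (u : ℝ) (hu : u ∈ Ioo s (2 * s)) : Comparable C (v t) (v u) :=
    hC t u ⟨hs.trans_le ht.1, hs.trans hu.1, by linarith [ht.2, hu.1], by linarith [ht.1, hu.2]⟩
  have hq' := one_div_nonneg.2 hq.le
  calc ENNReal.ofReal (v t)
      = 2 ^ (1 / q) * (ENNReal.ofReal (v t) * (1 / 2) ^ (1 / q)) := by
        rw [mul_left_comm, ← ENNReal.mul_rpow_of_nonneg _ _ hq', one_div 2,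
          ENNReal.mul_inv_cancel two_ne_zero ENNReal.ofNat_ne_top, ENNReal.one_rpow, mul_one]
    _ ≤ 2 ^ (1 / q) * (ENNReal.ofReal (v t) * logNorm q (Ioo s (2 * s)) (fun _ => 1)) := by
        simp only [logNorm, ENNReal.one_rpow, lintegral_one, Measure.restrict_apply_univ]
        gcongr
        exact one_half_le_logMeasure_Ioo hs
    _ ≤ 2 ^ (1 / q) * (C.toNNReal *
          logNorm q (Ioo s (2 * s)) (fun u => ENNReal.ofReal (v u))) := by
        rw [← logNorm_const_mul hq ENNReal.coe_ne_top, ← logNorm_const_mul hq (by finiteness)]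
        gcongr
        exact logNorm_mono hq measurableSet_Ioo fun u hu => by
          simpa only [mul_one] using (comparable u hu).ofReal_le
    _ = _ := by
        rw [ENNReal.coe_mul, ENNReal.coe_rpow_of_nonneg _ hq', ENNReal.coe_ofNat, mul_assoc]

theorem logMeasure_Ioc_le {s t : ℝ} (hs : 0 < s) :
    logMeasure (Ioc s t) ≤ ENNReal.ofReal (t / s) := by
  calc logMeasure (Ioc s t) = ∫⁻ u in Ioc s t, ENNReal.ofReal u⁻¹ :=
        withDensity_apply _ measurableSet_Ioc
    _ ≤ ∫⁻ _ in Ioc s t, ENNReal.ofReal s⁻¹ :=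
        setLIntegral_mono' measurableSet_Ioc fun u hu =>
          ENNReal.ofReal_le_ofReal (inv_anti₀ hs hu.1.le)
    _ = ENNReal.ofReal (s⁻¹ * (t - s)) := by
        rw [setLIntegral_const, Real.volume_Ioc, ENNReal.ofReal_mul (inv_nonneg.2 hs.le)]
    _ ≤ ENNReal.ofReal (t / s) := by
        rw [div_eq_inv_mul]
        gcongr
        linarith

theorem Doubling.exists_logNorm_Ioc_le {v : ℝ → ℝ} (hv : Doubling v) {q : ℝ} (hq : 0 < q)
    {D : ℝ} (hD : 1 ≤ D) : ∃ C : ℝ≥0, 0 < C ∧ ∀ s t : ℝ, 0 < s → t ≤ D * s →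
      logNorm q (Ioc s t) (fun u => ENNReal.ofReal (v u)) ≤ C * ENNReal.ofReal (v s) := by
  have hDpos : 0 < D := one_pos.trans_le hD
  obtain ⟨C, hC⟩ := hv D
  have hCpos : 0 < C := (hC 1 1 ((Comparable.refl one_pos).mono hD)).const_pos
  refine ⟨C.toNNReal * D.toNNReal ^ (1 / q),
    mul_pos (Real.toNNReal_pos.2 hCpos) (NNReal.rpow_pos (Real.toNNReal_pos.2 hDpos)),
    fun s t hs ht => ?_⟩
  have hvu (u : ℝ) (hu : u ∈ Ioc s t) :
      ENNReal.ofReal (v u) ≤ C.toNNReal * ENNReal.ofReal (v s) * 1 := by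
    have hu₀ := hs.trans hu.1
    rw [mul_one]
    refine (hC u s ⟨hu₀, hs, hu.2.trans ht, hu.1.le.trans ?_⟩).ofReal_le
    exact le_mul_of_one_le_left hu₀.le hD
  calc logNorm q (Ioc s t) (fun u => ENNReal.ofReal (v u))
      ≤ C.toNNReal * ENNReal.ofReal (v s) * logNorm q (Ioc s t) fun _ => 1 := by
        rw [← logNorm_const_mul hq (by finiteness)]
        exact logNorm_mono hq measurableSet_Ioc hvu
    _ ≤ C.toNNReal * ENNReal.ofReal (v s) * ENNReal.ofReal D ^ (1 / q) := by
        simp only [logNorm, ENNReal.one_rpow, lintegral_one, Measure.restrict_apply_univ]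
        gcongr
        exact (logMeasure_Ioc_le hs).trans (ENNReal.ofReal_le_ofReal ((div_le_iff₀ hs).2 ht))
    _ = _ := by
        rw [ENNReal.coe_mul, ENNReal.coe_rpow_of_nonneg _ (one_div_nonneg.2 hq.le), mul_right_comm,
          ENNReal.ofReal]

/-! ### Tail norms and grids -/

/-- A weight in `SV_{0,q}` with a positive exponent `q`. -/
structure TailWeight (q : ℝ) (b : ℝ → ℝ) : Prop where
  exponent_pos : 0 < q
  isSV0 : IsSV0 q b

theorem tailENorm_eq_logNorm {q t : ℝ} (hq : 0 < q) (ht : 0 ≤ t) (b : ℝ → ℝ) :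
    tailENorm q b t = logNorm q (Ioi t) fun u => ENNReal.ofReal (b u) := by
  simpa only [tailENorm, zero_sub, mul_one, Real.rpow_zero, one_mul] using
    lqNorm_eq_logNorm hq measurableSet_Ioi (Ioi_subset_Ioi ht) 0 b fun _ => 1

theorem tailENorm_mul_le_logNorm {q t : ℝ} (hq : 0 < q) (ht : 0 ≤ t) (b : ℝ → ℝ)
    {F : ℝ → ℝ≥0∞} (hF : Monotone F) :
    tailENorm q b t * F t ≤ logNorm q (Ioi t) fun u => ENNReal.ofReal (b u) * F u := by
  rw [tailENorm_eq_logNorm hq ht]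
  exact logNorm_mul_le_logNorm_mul hq measurableSet_Ioi _ fun u hu => hF (le_of_lt hu)

namespace TailWeight

variable {q : ℝ} {b : ℝ → ℝ}

theorem potter (hb : TailWeight q b) : Potter b :=
  hb.isSV0.isSV.potter

theorem tailENorm_anti (hb : TailWeight q b) {s t : ℝ} (hs : 0 < s) (hst : s ≤ t) :
    tailENorm q b t ≤ tailENorm q b s := by
  rw [tailENorm_eq_logNorm hb.exponent_pos hs.le,
    tailENorm_eq_logNorm hb.exponent_pos (hs.le.trans hst)]
  exact logNorm_mono_set hb.exponent_pos (Ioi_subset_Ioi hst)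

theorem exists_tailENorm_le (hb : TailWeight q b) {ε : ℝ} (hε : 0 < ε) :
    ∃ C : ℝ, 1 ≤ C ∧ ∀ s t : ℝ, 0 < s → s ≤ t →
      tailENorm q b s ≤ ENNReal.ofReal (C * (t / s) ^ ε) * tailENorm q b t := by
  obtain ⟨C, hC⟩ := hb.potter.of_le_comparable hε
  refine ⟨C, by simpa using (hC 1 1 one_pos le_rfl).one_le, fun s t hs hst => ?_⟩
  have ht := hs.trans_le hst
  have hscale : 0 < s / t := div_pos hs ht
  rw [tailENorm_eq_logNorm hb.exponent_pos hs.le, tailENorm_eq_logNorm hb.exponent_pos ht.le,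
    ← logNorm_comp_mul hscale, preimage_const_mul_Ioi₀ _ hscale, div_div_cancel₀ hs.ne',
    ← logNorm_const_mul hb.exponent_pos ENNReal.ofReal_ne_top]
  refine logNorm_mono hb.exponent_pos measurableSet_Ioi fun u hu => ?_
  have hu₀ : 0 < u := ht.trans hu
  have hle := hC (s / t * u) u (by positivity)
    (mul_le_of_le_one_left hu₀.le ((div_le_one ht).2 hst))
  rw [div_mul_cancel_right₀ hu₀.ne', inv_div] at hle
  exact hle.ofReal_le

theorem tailENorm_lt_top (hb : TailWeight q b) {t : ℝ} (ht : 0 < t) : tailENorm q b t < ∞ := by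
  rcases le_total 1 t with h | h
  · exact (hb.tailENorm_anti one_pos h).trans_lt hb.isSV0.tail_lt_top
  · obtain ⟨C, -, hC⟩ := hb.exists_tailENorm_le one_pos
    exact (hC t 1 ht h).trans_lt (ENNReal.mul_lt_top ENNReal.ofReal_lt_top hb.isSV0.tail_lt_top)

theorem ofReal_tailNorm (hb : TailWeight q b) {t : ℝ} (ht : 0 < t) :
    ENNReal.ofReal (tailNorm q b t) = tailENorm q b t :=
  ENNReal.ofReal_toReal (hb.tailENorm_lt_top ht).ne

theorem exists_le_tailENorm (hb : TailWeight q b) : ∃ C : ℝ≥0, ∀ t : ℝ, 0 < t →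
    ENNReal.ofReal (b t) ≤ C * tailENorm q b t := by
  obtain ⟨C, hC⟩ := hb.potter.doubling.exists_le_logNorm_Ioo hb.exponent_pos
  refine ⟨C, fun t ht => (hC t t ht ⟨le_rfl, by linarith⟩).trans ?_⟩
  rw [tailENorm_eq_logNorm hb.exponent_pos ht.le]
  gcongr
  exact logNorm_mono_set hb.exponent_pos Ioo_subset_Ioi_self

theorem tailNorm_pos (hb : TailWeight q b) {t : ℝ} (ht : 0 < t) : 0 < tailNorm q b t := by
  obtain ⟨C, hC⟩ := hb.exists_le_tailENorm
  refine ENNReal.toReal_pos (fun h => ?_) (hb.tailENorm_lt_top ht).ne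
  have hbt := hC t ht
  rw [h, mul_zero, nonpos_iff_eq_zero, ENNReal.ofReal_eq_zero] at hbt
  exact hbt.not_gt (hb.potter.pos ht)

theorem tailNorm_anti (hb : TailWeight q b) {s t : ℝ} (hs : 0 < s) (hst : s ≤ t) :
    tailNorm q b t ≤ tailNorm q b s :=
  ENNReal.toReal_mono (hb.tailENorm_lt_top hs).ne (hb.tailENorm_anti hs hst)

theorem potter_tailNorm (hb : TailWeight q b) : Potter (tailNorm q b) := by
  refine Potter.of_le fun ε hε => ?_
  obtain ⟨C, hC₁, hC⟩ := hb.exists_tailENorm_le hε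
  refine ⟨C, fun s t hs hst => ?_⟩
  have ht := hs.trans_le hst
  have hfactor : 1 ≤ C * (t / s) ^ ε :=
    one_le_mul_of_one_le_of_one_le hC₁ (Real.one_le_rpow ((one_le_div hs).2 hst) hε.le)
  refine ⟨hb.tailNorm_pos hs, hb.tailNorm_pos ht, ?_, (hb.tailNorm_anti hs hst).trans
    (le_mul_of_one_le_left (hb.tailNorm_pos hs).le hfactor)⟩
  refine (ENNReal.ofReal_le_ofReal_iff
    (mul_nonneg (by positivity) (hb.tailNorm_pos ht).le)).1 ?_
  rw [ENNReal.ofReal_mul (by positivity), hb.ofReal_tailNorm hs, hb.ofReal_tailNorm ht]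
  exact hC s t hs hst

theorem aemeasurable_tailNorm (hb : TailWeight q b) :
    AEMeasurable (tailNorm q b) (volume.restrict (Ioi 0)) :=
  aemeasurable_restrict_of_antitoneOn measurableSet_Ioi fun _ hs _ _ hst => hb.tailNorm_anti hs hst

theorem lintegral_Ioi_rpow_div (hb : TailWeight q b) {t : ℝ} (ht : 0 < t) :
    ∫⁻ u in Ioi t, ENNReal.ofReal (b u ^ q / u) = ENNReal.ofReal (tailNorm q b t ^ q) := by
  rw [← ENNReal.ofReal_rpow_of_pos (hb.tailNorm_pos ht), hb.ofReal_tailNorm ht,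
    tailENorm_eq_logNorm hb.exponent_pos ht.le, logNorm_rpow_self hb.exponent_pos,
    setLIntegral_logMeasure measurableSet_Ioi]
  refine setLIntegral_congr_fun measurableSet_Ioi fun u hu => ?_
  have hu₀ : 0 < u := ht.trans hu
  rw [ENNReal.ofReal_rpow_of_pos (hb.potter.pos hu₀), ← ENNReal.ofReal_mul (inv_nonneg.2 hu₀.le),
    div_eq_inv_mul]

theorem ae_rpow_div_nonneg (hb : TailWeight q b) {t : ℝ} (ht : 0 < t) :
    0 ≤ᵐ[volume.restrict (Ioi t)] fun u => b u ^ q / u := by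
  filter_upwards [ae_restrict_mem measurableSet_Ioi] with u hu
  have hu₀ : 0 < u := ht.trans hu
  exact div_nonneg (Real.rpow_nonneg (hb.potter.pos hu₀).le q) hu₀.le

theorem integrableOn_rpow_div (hb : TailWeight q b) {t : ℝ} (ht : 0 < t) :
    IntegrableOn (fun u => b u ^ q / u) (Ioi t) := by
  have hmeas : AEMeasurable b (volume.restrict (Ioi t)) :=
    hb.isSV0.isSV.aemeasurable.mono_measure (Measure.restrict_mono (Ioi_subset_Ioi ht.le) le_rfl)
  refine ⟨((hmeas.pow_const q).div aemeasurable_id).aestronglyMeasurable, ?_⟩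
  rw [hasFiniteIntegral_iff_ofReal (hb.ae_rpow_div_nonneg ht), hb.lintegral_Ioi_rpow_div ht]
  exact ENNReal.ofReal_lt_top

theorem integral_Ioi_rpow_div (hb : TailWeight q b) {t : ℝ} (ht : 0 < t) :
    ∫ u in Ioi t, b u ^ q / u = tailNorm q b t ^ q := by
  rw [integral_eq_lintegral_of_nonneg_ae (hb.ae_rpow_div_nonneg ht)
    (hb.integrableOn_rpow_div ht).aestronglyMeasurable, hb.lintegral_Ioi_rpow_div ht,
    ENNReal.toReal_ofReal (Real.rpow_nonneg (hb.tailNorm_pos ht).le q)]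

theorem exists_tailNorm_eq (hb : TailWeight q b) {s y : ℝ} (hs : 0 < s)
    (hsy : y ≤ tailNorm q b s) (hy : 0 < y) : ∃ t, 0 < t ∧ tailNorm q b t = y := by
  have hlim : Tendsto (fun x => ∫ u in Ioi x, b u ^ q / u) atTop (nhds 0) :=
    tendsto_integral_Ioi_zero tendsto_id
  obtain ⟨t, ht_lt, hst⟩ := ((hlim.eventually (gt_mem_nhds (Real.rpow_pos_of_pos hy q))).and
    (eventually_ge_atTop s)).exists
  have hcont : ContinuousOn (fun x => ∫ u in Ioi x, b u ^ q / u) (Icc s t) :=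
    (hb.integrableOn_rpow_div hs).continuousOn_Ici_primitive_Ioi.mono Icc_subset_Ici_self
  have hs_le : y ^ q ≤ ∫ u in Ioi s, b u ^ q / u := by
    rw [hb.integral_Ioi_rpow_div hs]
    exact Real.rpow_le_rpow hy.le hsy hb.exponent_pos.le
  obtain ⟨x, hx, hxy⟩ := intermediate_value_Icc' hst hcont ⟨ht_lt.le, hs_le⟩
  have hx₀ : 0 < x := hs.trans_le hx.1
  have hpow : tailNorm q b x ^ q = y ^ q := (hb.integral_Ioi_rpow_div hx₀).symm.trans hxy
  exact ⟨x, hx₀,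
    (Real.rpow_left_inj (hb.tailNorm_pos hx₀).le hy.le hb.exponent_pos.ne').1 hpow⟩

theorem logNorm_Ioc_mul_le (hb : TailWeight q b) {F : ℝ → ℝ≥0∞}
    (hF : Monotone F) {s : ℝ} (hs : 0 < s) (t : ℝ) :
    logNorm q (Ioc s t) (fun u => ENNReal.ofReal (b u) * F u) ≤ tailENorm q b s * F t := by
  refine GenGamma.logNorm_Ioc_mul_le hb.exponent_pos hF ?_ ?_
  · rw [← hb.ofReal_tailNorm hs]
    exact (ENNReal.ofReal_pos.2 (hb.tailNorm_pos hs)).ne'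
  · rw [tailENorm_eq_logNorm hb.exponent_pos hs.le]
    exact logNorm_mono_set hb.exponent_pos Ioc_subset_Ioi_self

theorem logNorm_Ioc_rpow_div {q' : ℝ} (hb : TailWeight q b) (hq' : 0 < q')
    {s t : ℝ} (hs : 0 < s) (hst : s ≤ t) :
    logNorm q' (Ioc s t) (fun u => ENNReal.ofReal (b u ^ (q / q'))) =
      ENNReal.ofReal ((tailNorm q b s ^ q - tailNorm q b t ^ q) ^ (1 / q')) := by
  have hq := hb.exponent_pos
  have ht := hs.trans_le hst
  have hAt := (Real.rpow_pos_of_pos (hb.tailNorm_pos ht) q).le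
  have tail_eq {x : ℝ} (hx : 0 < x) : ∫⁻ u in Ioi x, ENNReal.ofReal (b u) ^ q ∂logMeasure =
      ENNReal.ofReal (tailNorm q b x ^ q) := by
    rw [← logNorm_rpow_self hq, ← tailENorm_eq_logNorm hq hx.le, ← hb.ofReal_tailNorm hx,
      ENNReal.ofReal_rpow_of_pos (hb.tailNorm_pos hx)]
  have hadd : ∫⁻ u in Ioc s t, ENNReal.ofReal (b u) ^ q ∂logMeasure +
      ENNReal.ofReal (tailNorm q b t ^ q) = ENNReal.ofReal (tailNorm q b s ^ q) := by
    rw [← tail_eq hs, ← tail_eq ht, ← Ioc_union_Ioi_eq_Ioi hst,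
      lintegral_union measurableSet_Ioi (Ioc_disjoint_Ioi le_rfl)]
  have hpow : ∫⁻ u in Ioc s t, ENNReal.ofReal (b u ^ (q / q')) ^ q' ∂logMeasure =
      ∫⁻ u in Ioc s t, ENNReal.ofReal (b u) ^ q ∂logMeasure :=
    setLIntegral_congr_fun measurableSet_Ioc fun u hu => by
      rw [← ENNReal.ofReal_rpow_of_pos (hb.potter.pos (hs.trans hu.1)), ← ENNReal.rpow_mul,
        div_mul_cancel₀ q hq'.ne']
  rw [logNorm, hpow, ENNReal.eq_sub_of_add_eq ENNReal.ofReal_ne_top hadd,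
    ← ENNReal.ofReal_sub _ hAt, ENNReal.ofReal_rpow_of_nonneg
      (sub_nonneg.2 (Real.rpow_le_rpow (hb.tailNorm_pos ht).le (hb.tailNorm_anti hs hst) hq.le))
      (one_div_nonneg.2 hq'.le)]

end TailWeight

/-- The half-open intervals `(t k, t (k + 1)]` partition `(0, ∞)`. -/
structure IsPartition (t : ℤ → ℝ) : Prop where
  monotone : Monotone t
  pos : ∀ k, 0 < t k
  exists_lt : ∀ x, 0 < x → ∃ k, t k < x
  exists_ge : ∀ x, ∃ k, x ≤ t k

theorem two_pow_mul_le {x : ℤ → ℝ} (hx : ∀ k, 2 * x k ≤ x (k + 1)) (k : ℤ) (n : ℕ) :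
    2 ^ n * x k ≤ x (k + n) := by
  induction n with
  | zero => simp
  | succ n ih =>
    rw [pow_succ, Nat.cast_succ, ← add_assoc]
    linarith [hx (k + n)]

theorem IsPartition.of_two_mul_le {x : ℤ → ℝ} (hpos : ∀ k, 0 < x k)
    (hx : ∀ k, 2 * x k ≤ x (k + 1)) : IsPartition x where
  monotone := monotone_int_of_le_succ fun k => by linarith [hx k, hpos k]
  pos := hpos
  exists_lt y hy := by
    obtain ⟨n, hn⟩ := pow_unbounded_of_one_lt (x 0 / y) one_lt_two
    refine ⟨-n, ?_⟩
    have hle := two_pow_mul_le hx (-n) n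
    rw [neg_add_cancel] at hle
    exact lt_of_mul_lt_mul_left (hle.trans_lt ((div_lt_iff₀ hy).1 hn)) (by positivity)
  exists_ge y := by
    obtain ⟨n, hn⟩ := pow_unbounded_of_one_lt (y / x 0) one_lt_two
    exact ⟨0 + n, ((div_lt_iff₀ (hpos 0)).1 hn).le.trans (two_pow_mul_le hx 0 n)⟩

theorem IsPartition.of_antitoneOn {A : ℝ → ℝ} {t : ℤ → ℝ} (hApos : ∀ s, 0 < s → 0 < A s)
    (hA : AntitoneOn A (Ioi 0)) (hpos : ∀ k, 0 < t k) (hAt : ∀ k, 2 * A (t (k + 1)) ≤ A (t k)) :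
    IsPartition t := by
  have lt_of_lt {r s : ℝ} (hs : 0 < s) (hrs : A s < A r) : r < s := by
    by_contra! h
    exact hrs.not_ge (hA hs (hs.trans_le h) h)
  have hinv : IsPartition fun k => (A (t k))⁻¹ := by
    refine .of_two_mul_le (fun k => inv_pos.2 (hApos _ (hpos k))) fun k => ?_
    rw [← div_eq_mul_inv, div_le_iff₀ (hApos _ (hpos k)), ← div_eq_inv_mul,
      le_div_iff₀ (hApos _ (hpos _))]
    exact hAt k
  refine ⟨monotone_int_of_le_succ fun k => (lt_of_lt (hpos _) ?_).le, hpos, fun s hs => ?_,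
    fun s => ?_⟩
  · linarith [hAt k, hApos _ (hpos (k + 1))]
  · obtain ⟨k, hk⟩ := hinv.exists_lt (A s)⁻¹ (inv_pos.2 (hApos s hs))
    exact ⟨k, lt_of_lt hs ((inv_lt_inv₀ (hApos _ (hpos k)) (hApos s hs)).1 hk)⟩
  · rcases le_or_gt s 0 with hs | hs
    · exact ⟨0, hs.trans (hpos 0).le⟩
    have hAs := inv_pos.2 (hApos s hs)
    obtain ⟨k, hk⟩ := hinv.exists_ge (2 * (A s)⁻¹)
    refine ⟨k, (lt_of_lt (hpos k) ?_).le⟩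
    exact (inv_lt_inv₀ (hApos s hs) (hApos _ (hpos k))).1 (by linarith)

section Rho

variable {q₀ q₁ : ℝ} {b₀ b₁ : ℝ → ℝ}

theorem rho_pos (h₀ : TailWeight q₀ b₀) (h₁ : TailWeight q₁ b₁) {t : ℝ} (ht : 0 < t) :
    0 < rho q₀ q₁ b₀ b₁ t :=
  div_pos (h₀.tailNorm_pos ht) (h₁.tailNorm_pos ht)

theorem rho_mul_tailNorm (h₁ : TailWeight q₁ b₁) {t : ℝ} (ht : 0 < t) :
    rho q₀ q₁ b₀ b₁ t * tailNorm q₁ b₁ t = tailNorm q₀ b₀ t :=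
  div_mul_cancel₀ _ (h₁.tailNorm_pos ht).ne'

theorem potter_rho (h₀ : TailWeight q₀ b₀) (h₁ : TailWeight q₁ b₁) :
    Potter (rho q₀ q₁ b₀ b₁) := by
  have hdiv := h₀.potter_tailNorm.mul (h₁.potter_tailNorm.rpow (-1))
  simp only [Real.rpow_neg_one, ← div_eq_mul_inv] at hdiv
  exact hdiv

theorem exists_le_tailNorm_of_tendsto_rho (h₀ : TailWeight q₀ b₀) (h₁ : TailWeight q₁ b₁)
    (hzero : Tendsto (rho q₀ q₁ b₀ b₁) (nhdsWithin 0 (Ioi 0)) (nhds 0)) {y : ℝ} (hy : 0 < y) :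
    ∃ t, 0 < t ∧ y ≤ tailNorm q₁ b₁ t := by
  have hρ := hzero.eventually (gt_mem_nhds (div_pos (h₀.tailNorm_pos one_pos) hy))
  have hle_one : ∀ᶠ t : ℝ in nhdsWithin 0 (Ioi 0), t ≤ 1 :=
    nhdsWithin_le_nhds (ge_mem_nhds one_pos)
  obtain ⟨t, ⟨hρt, ht₁⟩, ht⟩ := ((hρ.and hle_one).and self_mem_nhdsWithin).exists
  refine ⟨t, ht, ?_⟩
  rw [rho, div_lt_div_iff₀ (h₁.tailNorm_pos ht) hy] at hρt
  by_contra! hlt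
  nlinarith [h₀.tailNorm_anti ht ht₁, h₀.tailNorm_pos one_pos]

theorem rho_rpow_one_add (h₀ : TailWeight q₀ b₀) (h₁ : TailWeight q₁ b₁) (ε : ℝ) {t : ℝ}
    (ht : 0 < t) :
    rho q₀ q₁ b₀ b₁ t ^ (1 + ε) = rhoEps q₀ q₁ b₀ b₁ ε t / tailNorm q₁ b₁ t ^ ε := by
  have hA₁ := h₁.tailNorm_pos ht
  rw [rho, rhoEps, Real.div_rpow (h₀.tailNorm_pos ht).le hA₁.le, Real.rpow_add hA₁,
    Real.rpow_one, div_div]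

/-- Between two points where `A₁ = ‖u^{-1/q₁} b₁‖_{(·,∞)}` has ratio `M`, the identity
`ρ^{1+ε} = ρ_ε A₁^{-ε}` gives `ρ` a gain of order `M^{ε/(1+ε)}`. -/
theorem RhoCondition.exists_two_mul_rho_le (h₀ : TailWeight q₀ b₀) (h₁ : TailWeight q₁ b₁)
    (hcond : RhoCondition q₀ q₁ b₀ b₁) : ∃ M : ℝ, 2 ≤ M ∧ ∀ s t : ℝ, 0 < s → s ≤ t →
      tailNorm q₁ b₁ s = M * tailNorm q₁ b₁ t →
      2 * rho q₀ q₁ b₀ b₁ s ≤ rho q₀ q₁ b₀ b₁ t := by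
  obtain ⟨ε, hε, g, hg, heq⟩ := hcond
  obtain ⟨C, hC⟩ := heq.almostMonotone hg
  have hρε {t : ℝ} (ht : 0 < t) : 0 < rhoEps q₀ q₁ b₀ b₁ ε t :=
    div_pos (Real.rpow_pos_of_pos (h₀.tailNorm_pos ht) _) (h₁.tailNorm_pos ht)
  have hCpos : 0 < C := pos_of_mul_pos_left
    ((hρε one_pos).trans_le (hC 1 1 one_pos le_rfl)) (hρε one_pos).le
  set M : ℝ := max 2 ((2 ^ (1 + ε) * C) ^ ε⁻¹)
  have hMpos : 0 < M := two_pos.trans_le (le_max_left ..)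
  have hM : 2 ^ (1 + ε) * C ≤ M ^ ε :=
    (Real.rpow_inv_le_iff_of_pos (by positivity) hMpos.le hε).1 (le_max_right ..)
  refine ⟨M, le_max_left .., fun s t hs hst hMst => ?_⟩
  have ht := hs.trans_le hst
  have hA₁ := h₁.tailNorm_pos ht
  have hρs := rho_pos h₀ h₁ hs
  refine (Real.rpow_le_rpow_iff (by positivity) (rho_pos h₀ h₁ ht).le
    (by positivity : 0 < 1 + ε)).1 ?_
  rw [Real.mul_rpow two_pos.le hρs.le, rho_rpow_one_add h₀ h₁ ε hs, rho_rpow_one_add h₀ h₁ ε ht,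
    hMst, Real.mul_rpow hMpos.le hA₁.le, ← div_div, mul_div_assoc']
  gcongr
  rw [mul_div_assoc', div_le_iff₀ (by positivity)]
  calc 2 ^ (1 + ε) * rhoEps q₀ q₁ b₀ b₁ ε s
      ≤ 2 ^ (1 + ε) * (C * rhoEps q₀ q₁ b₀ b₁ ε t) := by gcongr; exact hC s t hs hst
    _ = rhoEps q₀ q₁ b₀ b₁ ε t * (2 ^ (1 + ε) * C) := by ring
    _ ≤ rhoEps q₀ q₁ b₀ b₁ ε t * M ^ ε := by gcongr; exact (hρε ht).le

/-- A partition of `(0, ∞)` along which the second tail norm decreases geometrically with ratio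
`M` and `ρ` increases geometrically, each step by a factor in `[2, M]`. -/
structure IsGrid (q₀ q₁ : ℝ) (b₀ b₁ : ℝ → ℝ) (M : ℝ) (t : ℤ → ℝ) : Prop extends
    IsPartition t where
  two_le : 2 ≤ M
  tailNorm_eq : ∀ k, tailNorm q₁ b₁ (t k) = M * tailNorm q₁ b₁ (t (k + 1))
  two_mul_rho_le : ∀ k, 2 * rho q₀ q₁ b₀ b₁ (t k) ≤ rho q₀ q₁ b₀ b₁ (t (k + 1))
  rho_le_mul : ∀ k, rho q₀ q₁ b₀ b₁ (t (k + 1)) ≤ M * rho q₀ q₁ b₀ b₁ (t k)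

theorem RhoCondition.exists_isGrid (h₀ : TailWeight q₀ b₀) (h₁ : TailWeight q₁ b₁)
    (hcond : RhoCondition q₀ q₁ b₀ b₁)
    (hzero : Tendsto (rho q₀ q₁ b₀ b₁) (nhdsWithin 0 (Ioi 0)) (nhds 0)) :
    ∃ M t, IsGrid q₀ q₁ b₀ b₁ M t := by
  obtain ⟨M, hM, hρ⟩ := hcond.exists_two_mul_rho_le h₀ h₁
  have hMpos : 0 < M := two_pos.trans_le hM
  have exists_point (k : ℤ) : ∃ t, 0 < t ∧ tailNorm q₁ b₁ t = M ^ (-k) := by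
    have hpow : 0 < M ^ (-k) := zpow_pos hMpos _
    obtain ⟨s, hs, hsk⟩ := exists_le_tailNorm_of_tendsto_rho h₀ h₁ hzero hpow
    exact h₁.exists_tailNorm_eq hs hsk hpow
  choose t htpos ht using exists_point
  have htail (k : ℤ) : tailNorm q₁ b₁ (t k) = M * tailNorm q₁ b₁ (t (k + 1)) := by
    rw [ht, ht, ← zpow_one_add₀ hMpos.ne']
    congr 1
    ring
  have hpart : IsPartition t := by
    refine .of_antitoneOn (fun s => h₁.tailNorm_pos) (fun r hr s _ => h₁.tailNorm_anti hr) htpos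
      fun k => ?_
    rw [htail k]
    exact mul_le_mul_of_nonneg_right hM (h₁.tailNorm_pos (htpos _)).le
  have hstep (k : ℤ) : t k ≤ t (k + 1) := hpart.monotone (Int.lt_succ k).le
  refine ⟨M, t, hpart, hM, htail, fun k => hρ _ _ (htpos k) (hstep k) (htail k), fun k => ?_⟩
  have hA₁ := h₁.tailNorm_pos (htpos (k + 1))
  rw [rho, rho, htail k, mul_div_assoc', mul_div_mul_left _ _ hMpos.ne']
  exact div_le_div_of_nonneg_right (h₀.tailNorm_anti (htpos k) (hstep k)) hA₁.le

end Rho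

/-! ### Rearrangements -/

/-- The truncation of a real number to the interval `[-c, c]`. -/
def clip (c y : ℝ) : ℝ :=
  max (-c) (min c y)

theorem continuous_clip (c : ℝ) : Continuous (clip c) := by
  unfold clip
  fun_prop

theorem clip_of_abs_le {c y : ℝ} (hy : |y| ≤ c) : clip c y = y := by
  rw [clip, min_eq_right (abs_le.1 hy).2, max_eq_right (abs_le.1 hy).1]

theorem abs_clip_le {c : ℝ} (hc : 0 ≤ c) (y : ℝ) : |clip c y| ≤ c :=
  abs_le.2 ⟨le_max_left .., max_le (by linarith) (min_le_left ..)⟩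

theorem abs_clip_le_abs {c : ℝ} (hc : 0 ≤ c) (y : ℝ) : |clip c y| ≤ |y| := by
  rcases le_total |y| c with h | h
  · rw [clip_of_abs_le h]
  · exact (abs_clip_le hc y).trans h

theorem abs_sub_clip_le_abs {c : ℝ} (hc : 0 ≤ c) (y : ℝ) : |y - clip c y| ≤ |y| := by
  unfold clip
  rcases max_cases (-c) (min c y) with h | h <;> rcases min_cases c y with h' | h' <;>
    rcases abs_cases y with hy | hy <;> rw [h.1, abs_le] <;> constructor <;> linarith

section Rearrangement

variable {Ω : Type*} [MeasurableSpace Ω] {μ : Measure Ω}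

theorem rearrangement_antitone (f : Ω →ₘ[μ] ℝ) : Antitone (rearrangement f) := fun _ _ hst =>
  sInf_le_sInf fun _ hl => le_trans hl (ENNReal.ofReal_le_ofReal hst)

theorem rearrangement_mono {f g : Ω →ₘ[μ] ℝ} (h : ∀ᵐ x ∂μ, ‖f x‖ₑ ≤ ‖g x‖ₑ) (t : ℝ) :
    rearrangement f t ≤ rearrangement g t := by
  refine sInf_le_sInf fun l hl => le_trans (measure_mono_ae ?_) hl
  filter_upwards [h] with x hx hl
  exact lt_of_lt_of_le hl hx

theorem rearrangement_le_of_measure_le {f : Ω →ₘ[μ] ℝ} {l : ℝ≥0∞} {t : ℝ}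
    (h : μ {x | l < ‖f x‖ₑ} ≤ ENNReal.ofReal t) : rearrangement f t ≤ l :=
  sInf_le h

theorem rearrangement_le_of_ae_le {f : Ω →ₘ[μ] ℝ} {c : ℝ≥0∞} (h : ∀ᵐ x ∂μ, ‖f x‖ₑ ≤ c) (t : ℝ) :
    rearrangement f t ≤ c := by
  have hnull : μ {x | c < ‖f x‖ₑ} = 0 := by simpa only [not_le] using ae_iff.1 h
  exact rearrangement_le_of_measure_le (hnull.trans_le zero_le)

theorem measure_add_lt_enorm_le (f g : Ω →ₘ[μ] ℝ) (k l : ℝ≥0∞) :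
    μ {x | k + l < ‖(f + g) x‖ₑ} ≤ μ {x | k < ‖f x‖ₑ} + μ {x | l < ‖g x‖ₑ} := by
  refine le_trans (measure_mono_ae ?_) (measure_union_le _ _)
  filter_upwards [AEEqFun.coeFn_add f g] with x hx (hlt : k + l < ‖(f + g) x‖ₑ)
  change k < ‖f x‖ₑ ∨ l < ‖g x‖ₑ
  by_contra! h
  rw [hx, Pi.add_apply] at hlt
  exact hlt.not_ge ((enorm_add_le _ _).trans (add_le_add h.1 h.2))

theorem rearrangement_add_le (f g : Ω →ₘ[μ] ℝ) {s t : ℝ} (hs : 0 ≤ s) (ht : 0 ≤ t) :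
    rearrangement (f + g) (s + t) ≤ rearrangement f s + rearrangement g t := by
  refine le_of_le_of_eq ?_ (ENNReal.sInf_add).symm
  refine le_iInf₂ fun k hk => ?_
  rw [add_comm k]
  refine le_of_le_of_eq ?_ (ENNReal.sInf_add).symm
  refine le_iInf₂ fun l hl => rearrangement_le_of_measure_le ?_
  rw [add_comm l, ENNReal.ofReal_add hs ht]
  exact (measure_add_lt_enorm_le f g k l).trans (add_le_add hk hl)

theorem measure_rearrangement_lt_le (f : Ω →ₘ[μ] ℝ) (t : ℝ) :
    μ {x | rearrangement f t < ‖f x‖ₑ} ≤ ENNReal.ofReal t := by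
  rcases eq_or_ne (rearrangement f t) ∞ with htop | hfin
  · simp only [htop, not_top_lt, ofPred_false, measure_empty, zero_le]
  obtain ⟨u, hu, hmem, hlim⟩ := exists_seq_strictAnti_tendsto' (lt_top_iff_ne_top.2 hfin)
  have hunion : {x | rearrangement f t < ‖f x‖ₑ} = ⋃ n, {x | u n < ‖f x‖ₑ} := by
    ext x
    simp only [mem_ofPred_eq, mem_iUnion]
    exact ⟨fun hx => (hlim.eventually (gt_mem_nhds hx)).exists,
      fun ⟨n, hn⟩ => (hmem n).1.trans hn⟩
  have hmono : Monotone fun n => {x | u n < ‖f x‖ₑ} := fun m n hmn x hx =>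
    (hu.antitone hmn).trans_lt hx
  rw [hunion, hmono.measure_iUnion]
  refine iSup_le fun n => ?_
  obtain ⟨l, hl, hln⟩ := sInf_lt_iff.1 (hmem n).1
  exact (measure_mono fun x hx => hln.trans hx).trans hl

/-- The function `f` truncated at height `c`. -/
def truncate (c : ℝ) (f : Ω →ₘ[μ] ℝ) : Ω →ₘ[μ] ℝ :=
  f.comp (clip c) (continuous_clip c)

theorem truncate_ae_eq (c : ℝ) (f : Ω →ₘ[μ] ℝ) : ∀ᵐ x ∂μ, truncate c f x = clip c (f x) :=
  AEEqFun.coeFn_comp _ (continuous_clip c) f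

theorem sub_truncate_ae_eq (c : ℝ) (f : Ω →ₘ[μ] ℝ) :
    ∀ᵐ x ∂μ, (f - truncate c f) x = f x - clip c (f x) := by
  filter_upwards [truncate_ae_eq c f, AEEqFun.coeFn_sub f (truncate c f)] with x hx hsub
  rw [hsub, Pi.sub_apply, hx]

section Truncate

variable {c : ℝ}

theorem rearrangement_truncate_le (hc : 0 ≤ c) (f : Ω →ₘ[μ] ℝ) (τ : ℝ) :
    rearrangement (truncate c f) τ ≤ rearrangement f τ := by
  refine rearrangement_mono ?_ τ
  filter_upwards [truncate_ae_eq c f] with x hx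
  rw [hx, enorm_le_iff_norm_le]
  exact abs_clip_le_abs hc _

theorem rearrangement_truncate_le_height (hc : 0 ≤ c) (f : Ω →ₘ[μ] ℝ) (τ : ℝ) :
    rearrangement (truncate c f) τ ≤ ENNReal.ofReal c := by
  refine rearrangement_le_of_ae_le ?_ τ
  filter_upwards [truncate_ae_eq c f] with x hx
  rw [hx, ← ofReal_norm]
  exact ENNReal.ofReal_le_ofReal (abs_clip_le hc _)

theorem rearrangement_sub_truncate_le (hc : 0 ≤ c) (f : Ω →ₘ[μ] ℝ) (τ : ℝ) :
    rearrangement (f - truncate c f) τ ≤ rearrangement f τ := by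
  refine rearrangement_mono ?_ τ
  filter_upwards [sub_truncate_ae_eq c f] with x hx
  rw [hx, enorm_le_iff_norm_le]
  exact abs_sub_clip_le_abs hc _

theorem rearrangement_sub_truncate_eq_zero (hc : 0 ≤ c) (f : Ω →ₘ[μ] ℝ) (τ : ℝ)
    (h : rearrangement f τ ≤ ENNReal.ofReal c) :
    rearrangement (f - truncate c f) τ = 0 := by
  refine nonpos_iff_eq_zero.1 (rearrangement_le_of_measure_le ?_)
  refine (measure_mono_ae ?_).trans (measure_rearrangement_lt_le f τ)
  filter_upwards [sub_truncate_ae_eq c f] with x hx (hlt : 0 < ‖(f - truncate c f) x‖ₑ)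
  refine h.trans_lt (show ENNReal.ofReal c < ‖f x‖ₑ from ?_)
  rw [← ofReal_norm, ENNReal.ofReal_lt_ofReal_iff_of_nonneg hc]
  by_contra! hle
  rw [hx, clip_of_abs_le hle, sub_self, enorm_zero] at hlt
  exact hlt.false

end Truncate

end Rearrangement

/-- The inner quasi-norm `‖τ^{1/p-1/r} w(τ) f^*(τ)‖_{r,(0,t)}` of `Γ(r,q,p;b,w)`, written with
respect to `dτ / τ`. -/
def innerNorm {Ω : Type*} [MeasurableSpace Ω] {μ : Measure Ω} (r p : ℝ) (w : ℝ → ℝ)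
    (f : Ω →ₘ[μ] ℝ) (t : ℝ) : ℝ≥0∞ :=
  logNorm r (Ioo 0 t) fun τ => ENNReal.ofReal (τ ^ (1 / p) * w τ) * rearrangement f τ

section InnerNorm

variable {Ω : Type*} [MeasurableSpace Ω] {μ : Measure Ω} {r p : ℝ} {w : ℝ → ℝ}

theorem innerNorm_monotone (hr : 0 < r) (f : Ω →ₘ[μ] ℝ) : Monotone (innerNorm r p w f) :=
  fun _ _ hst => logNorm_mono_set hr (Ioo_subset_Ioo_right hst)

theorem innerNorm_mono (hr : 0 < r) {f g : Ω →ₘ[μ] ℝ}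
    (h : ∀ τ, rearrangement f τ ≤ rearrangement g τ) (t : ℝ) :
    innerNorm r p w f t ≤ innerNorm r p w g t :=
  logNorm_mono hr measurableSet_Ioo fun τ _ => by gcongr; exact h τ

theorem innerNorm_le_of_rearrangement_eq_zero (hr : 0 < r) {f : Ω →ₘ[μ] ℝ} {t : ℝ}
    (h : ∀ τ, t ≤ τ → rearrangement f τ = 0) (s : ℝ) :
    innerNorm r p w f s ≤ innerNorm r p w f t := by
  unfold innerNorm logNorm
  gcongr 1
  rw [← lintegral_indicator measurableSet_Ioo, ← lintegral_indicator measurableSet_Ioo]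
  refine lintegral_mono (indicator_le fun τ hτ => ?_)
  rcases lt_or_ge τ t with hτt | htτ
  · rw [indicator_of_mem (mem_Ioo.2 ⟨hτ.1, hτt⟩)]
  · beta_reduce
    rw [h τ htτ, mul_zero, ENNReal.zero_rpow_of_pos hr]
    exact zero_le

theorem exists_innerNorm_le_of_rearrangement_le (hr : 0 < r) (hp : 0 < p) (hw : Potter w) :
    ∃ C : ℝ≥0, ∀ (f : Ω →ₘ[μ] ℝ) (a : ℝ≥0), (∀ τ, rearrangement f τ ≤ a) → ∀ t, 0 < t →
      innerNorm r p w f t ≤ C * ENNReal.ofReal (t ^ (1 / p) * w t) * a := by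
  obtain ⟨C, hC⟩ := hw.exists_logNorm_Ioc_le hr (one_div_pos.2 hp)
  refine ⟨C, fun f a ha t ht => ?_⟩
  calc innerNorm r p w f t
      ≤ logNorm r (Ioo 0 t) (fun τ => a * ENNReal.ofReal (τ ^ (1 / p) * w τ)) :=
        logNorm_mono hr measurableSet_Ioo fun τ _ => by rw [mul_comm]; gcongr; exact ha τ
    _ = a * logNorm r (Ioo 0 t) (fun τ => ENNReal.ofReal (τ ^ (1 / p) * w τ)) :=
        logNorm_const_mul hr ENNReal.coe_ne_top _ _
    _ ≤ a * (C * ENNReal.ofReal (t ^ (1 / p) * w t)) := by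
        gcongr
        exact (logNorm_mono_set hr Ioo_subset_Ioc_self).trans (hC t ht)
    _ = _ := mul_comm _ _

theorem exists_rearrangement_le_innerNorm (hr : 0 < r) (p : ℝ) (hw : Potter w) :
    ∃ C : ℝ≥0, ∀ (f : Ω →ₘ[μ] ℝ) (t : ℝ), 0 < t →
      ENNReal.ofReal (t ^ (1 / p) * w t) * rearrangement f t ≤ C * innerNorm r p w f t := by
  obtain ⟨C, hC⟩ := (hw.doubling.rpow_mul (1 / p)).exists_le_logNorm_Ioo hr
  refine ⟨C, fun f t ht => ?_⟩
  have hhalf : 2 * (t / 2) = t := mul_div_cancel₀ t two_ne_zero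
  have hweight := hC (t / 2) t (half_pos ht) ⟨by linarith, hhalf.ge⟩
  rw [hhalf] at hweight
  calc ENNReal.ofReal (t ^ (1 / p) * w t) * rearrangement f t
      ≤ C * logNorm r (Ioo (t / 2) t) (fun τ => ENNReal.ofReal (τ ^ (1 / p) * w τ)) *
          rearrangement f t := by
        gcongr
    _ ≤ C * logNorm r (Ioo (t / 2) t) fun τ =>
          ENNReal.ofReal (τ ^ (1 / p) * w τ) * rearrangement f τ := by
        rw [mul_assoc]
        gcongr
        exact logNorm_mul_le_logNorm_mul hr measurableSet_Ioo _ fun τ hτ =>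
          rearrangement_antitone f hτ.2.le
    _ ≤ C * innerNorm r p w f t := by
        gcongr
        exact logNorm_mono_set hr (Ioo_subset_Ioo_left (half_pos ht).le)

theorem aemeasurable_innerNorm_integrand (hw : IsSV w) (p : ℝ) (f : Ω →ₘ[μ] ℝ) (t : ℝ) :
    AEMeasurable (fun τ => ENNReal.ofReal (τ ^ (1 / p) * w τ) * rearrangement f τ)
      (logMeasure.restrict (Ioo 0 t)) := by
  have hw' : AEMeasurable w (logMeasure.restrict (Ioo 0 t)) :=
    (hw.aemeasurable.mono_measure (Measure.restrict_mono Ioo_subset_Ioi_self le_rfl)).mono_ac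
      (logMeasure_absolutelyContinuous.restrict _)
  exact ((aemeasurable_id.pow_const _).mul hw').ennreal_ofReal.mul
    (rearrangement_antitone f).measurable.aemeasurable

theorem exists_innerNorm_add_le (hr : 0 < r) (p : ℝ) (hw : IsSV w) :
    ∃ C : ℝ≥0, ∀ (f g : Ω →ₘ[μ] ℝ) (t : ℝ), 0 ≤ t →
      innerNorm r p w (f + g) t ≤ C * (innerNorm r p w f t + innerNorm r p w g t) := by
  obtain ⟨C, hC⟩ := hw.potter.doubling.rpow_mul (1 / p) 2
  obtain ⟨C', hC'⟩ := exists_logNorm_add_le hr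
  set v : ℝ → ℝ≥0∞ := fun τ => ENNReal.ofReal (τ ^ (1 / p) * w τ)
  refine ⟨C.toNNReal * C', fun f g t ht => ?_⟩
  have hpre : (2⁻¹ * ·) ⁻¹' Ioo (0 : ℝ) (2⁻¹ * t) = Ioo 0 t := by
    rw [preimage_const_mul_Ioo₀ _ _ (by norm_num), zero_div,
      mul_div_cancel_left₀ _ (by norm_num)]
  have pointwise (τ : ℝ) (hτ : τ ∈ Ioo 0 t) : v τ * rearrangement (f + g) τ ≤ C.toNNReal *
      (v (2⁻¹ * τ) * rearrangement f (2⁻¹ * τ) + v (2⁻¹ * τ) * rearrangement g (2⁻¹ * τ)) := by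
    have hτ' : 0 < 2⁻¹ * τ := mul_pos (by norm_num) hτ.1
    have hadd := rearrangement_add_le f g hτ'.le hτ'.le
    rw [← two_mul, mul_inv_cancel_left₀ two_ne_zero] at hadd
    rw [← mul_add, ← mul_assoc]
    gcongr
    exact (hC τ _ ⟨hτ.1, hτ', by linarith, by linarith⟩).ofReal_le
  calc innerNorm r p w (f + g) t
      ≤ C.toNNReal * logNorm r (Ioo 0 (2⁻¹ * t)) (fun τ =>
          v τ * rearrangement f τ + v τ * rearrangement g τ) := by
        rw [← logNorm_comp_mul (inv_pos.2 two_pos), hpre,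
          ← logNorm_const_mul hr ENNReal.coe_ne_top]
        exact logNorm_mono hr measurableSet_Ioo pointwise
    _ ≤ C.toNNReal * (C' * (innerNorm r p w f (2⁻¹ * t) + innerNorm r p w g (2⁻¹ * t))) := by
        gcongr
        exact hC' _ _ _ (aemeasurable_innerNorm_integrand hw p f _)
    _ ≤ C.toNNReal * (C' * (innerNorm r p w f t + innerNorm r p w g t)) := by
        gcongr <;> exact innerNorm_monotone hr _ (by linarith)
    _ = _ := by rw [ENNReal.coe_mul, mul_assoc]

theorem gammaNorm_eq_logNorm {q : ℝ} (hr : 0 < r) (hq : 0 < q) (p : ℝ) (b w : ℝ → ℝ)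
    (f : Ω →ₘ[μ] ℝ) : gammaNorm r q p b w f =
      logNorm q (Ioi 0) fun t => ENNReal.ofReal (b t) * innerNorm r p w f t := by
  have houter := lqNorm_eq_logNorm hq measurableSet_Ioi subset_rfl 0 b (innerNorm r p w f)
  simp only [zero_sub, Real.rpow_zero, one_mul] at houter
  rw [← houter, gammaNorm]
  simp only [innerNorm, lqNorm_eq_logNorm hr measurableSet_Ioo Ioo_subset_Ioi_self]

end InnerNorm

/-! ### Estimates of the `K`-functional -/

section GammaNorm

variable {Ω : Type*} [MeasurableSpace Ω] {μ : Measure Ω} {r q p : ℝ} {b w : ℝ → ℝ}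

theorem tailENorm_mul_innerNorm_le_gammaNorm (hr : 0 < r) (hq : 0 < q) (p : ℝ) (b w : ℝ → ℝ)
    (f : Ω →ₘ[μ] ℝ) {t : ℝ} (ht : 0 ≤ t) :
    tailENorm q b t * innerNorm r p w f t ≤ gammaNorm r q p b w f := by
  rw [gammaNorm_eq_logNorm hr hq]
  exact (tailENorm_mul_le_logNorm hq ht b (innerNorm_monotone hr f)).trans
    (logNorm_mono_set hq (Ioi_subset_Ioi ht))

theorem exists_gammaNorm_le_add (hr : 0 < r) (hq : 0 < q) (p : ℝ) (b w : ℝ → ℝ) :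
    ∃ C : ℝ≥0, ∀ (f : Ω →ₘ[μ] ℝ) (t : ℝ), 0 < t → gammaNorm r q p b w f ≤
      C * (logNorm q (Ioc 0 t) (fun u => ENNReal.ofReal (b u) * innerNorm r p w f u) +
        logNorm q (Ioi t) fun u => ENNReal.ofReal (b u) * innerNorm r p w f u) := by
  obtain ⟨C, hC⟩ := exists_logNorm_union_le hq
  refine ⟨C, fun f t ht => ?_⟩
  rw [gammaNorm_eq_logNorm hr hq, ← Ioc_union_Ioi_eq_Ioi ht.le]
  exact hC _ _ _

theorem exists_gammaNorm_le_of_rearrangement_eq_zero (hr : 0 < r) (hq : 0 < q) (p : ℝ)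
    (b w : ℝ → ℝ) : ∃ C : ℝ≥0, ∀ (f : Ω →ₘ[μ] ℝ) (t : ℝ), 0 < t →
      (∀ τ, t ≤ τ → rearrangement f τ = 0) → innerNorm r p w f t ≠ ∞ →
      gammaNorm r q p b w f ≤
        C * (logNorm q (Ioc 0 t) (fun u => ENNReal.ofReal (b u) * innerNorm r p w f u) +
          tailENorm q b t * innerNorm r p w f t) := by
  obtain ⟨C, hC⟩ := exists_gammaNorm_le_add (μ := μ) hr hq p b w
  refine ⟨C, fun f t ht hzero hfin => (hC f t ht).trans ?_⟩
  gcongr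
  rw [tailENorm_eq_logNorm hq ht.le, mul_comm, ← logNorm_const_mul hq hfin]
  refine logNorm_mono hq measurableSet_Ioi fun u _ => ?_
  rw [mul_comm]
  gcongr
  exact innerNorm_le_of_rearrangement_eq_zero hr hzero u

theorem exists_gammaNorm_sub_truncate_le (hr : 0 < r) (hq : 0 < q) (p : ℝ) (b w : ℝ → ℝ) :
    ∃ C : ℝ≥0, ∀ (f : Ω →ₘ[μ] ℝ) (t c : ℝ), 0 < t → 0 ≤ c →
      rearrangement f t ≤ ENNReal.ofReal c → innerNorm r p w f t ≠ ∞ →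
      gammaNorm r q p b w (f - truncate c f) ≤
        C * (logNorm q (Ioc 0 t) (fun u => ENNReal.ofReal (b u) * innerNorm r p w f u) +
          tailENorm q b t * innerNorm r p w f t) := by
  obtain ⟨C, hC⟩ := exists_gammaNorm_le_of_rearrangement_eq_zero (μ := μ) hr hq p b w
  refine ⟨C, fun f t c ht hc hfc hfin => ?_⟩
  have vanish (τ : ℝ) (hτ : t ≤ τ) : rearrangement (f - truncate c f) τ = 0 :=
    rearrangement_sub_truncate_eq_zero hc f τ ((rearrangement_antitone f hτ).trans hfc)
  have inner_le (s : ℝ) : innerNorm r p w (f - truncate c f) s ≤ innerNorm r p w f s :=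
    innerNorm_mono hr (rearrangement_sub_truncate_le hc f) s
  refine (hC _ t ht vanish (ne_top_of_le_ne_top hfin (inner_le t))).trans ?_
  gcongr
  · exact logNorm_mono hq measurableSet_Ioc fun u _ => by gcongr; exact inner_le u
  · exact inner_le t

theorem exists_logNorm_Ioc_innerNorm_le (hr : 0 < r) (hq : 0 < q) (hp : 0 < p) (hb : Potter b)
    (hw : Potter w) : ∃ C : ℝ≥0, ∀ (f : Ω →ₘ[μ] ℝ) (a : ℝ≥0), (∀ τ, rearrangement f τ ≤ a) →
      ∀ t, 0 < t → logNorm q (Ioc 0 t) (fun u => ENNReal.ofReal (b u) * innerNorm r p w f u) ≤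
        C * ENNReal.ofReal (b t) * (ENNReal.ofReal (t ^ (1 / p) * w t) * a) := by
  obtain ⟨C, hC⟩ := exists_innerNorm_le_of_rearrangement_le (μ := μ) hr hp hw
  obtain ⟨C', hC'⟩ := (hb.mul hw).exists_logNorm_Ioc_le hq (one_div_pos.2 hp)
  have ofReal_mul (u : ℝ) (hu : 0 < u) : ENNReal.ofReal (u ^ (1 / p) * (b u * w u)) =
      ENNReal.ofReal (b u) * ENNReal.ofReal (u ^ (1 / p) * w u) := by
    rw [← ENNReal.ofReal_mul (hb.pos hu).le, mul_left_comm]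
  refine ⟨C * C', fun f a ha t ht => ?_⟩
  calc logNorm q (Ioc 0 t) (fun u => ENNReal.ofReal (b u) * innerNorm r p w f u)
      ≤ logNorm q (Ioc 0 t) (fun u => C * a * ENNReal.ofReal (u ^ (1 / p) * (b u * w u))) := by
        refine logNorm_mono hq measurableSet_Ioc fun u hu => ?_
        rw [ofReal_mul u hu.1, mul_left_comm, mul_right_comm]
        gcongr
        exact hC f a ha u hu.1
    _ ≤ C * a * (C' * ENNReal.ofReal (t ^ (1 / p) * (b t * w t))) := by
        rw [logNorm_const_mul hq (by finiteness)]
        gcongr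
        exact hC' t ht
    _ = _ := by rw [ofReal_mul t ht, ENNReal.coe_mul]; ring

theorem rearrangement_ne_top_of_innerNorm_ne_top (hr : 0 < r) (hw : Potter w)
    {f : Ω →ₘ[μ] ℝ} {t : ℝ} (ht : 0 < t) (hfin : innerNorm r p w f t ≠ ∞) :
    rearrangement f t ≠ ∞ := fun htop => by
  obtain ⟨C, hC⟩ := exists_rearrangement_le_innerNorm (μ := μ) hr p hw
  have hle := hC f t ht
  have hwt := hw.pos ht
  rw [htop, ENNReal.mul_top (ENNReal.ofReal_pos.2 (by positivity)).ne', top_le_iff] at hle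
  exact ENNReal.mul_ne_top ENNReal.coe_ne_top hfin hle

theorem exists_gammaNorm_le_of_rearrangement_le (hr : 0 < r) (hp : 0 < p)
    (hb : TailWeight q b) (hw : Potter w) : ∃ C : ℝ≥0, ∀ (f g : Ω →ₘ[μ] ℝ) (t : ℝ), 0 < t →
      (∀ τ, rearrangement g τ ≤ rearrangement f τ) →
      (∀ τ, rearrangement g τ ≤ rearrangement f t) → rearrangement f t ≠ ∞ →
      gammaNorm r q p b w g ≤
        C * logNorm q (Ioi t) fun u => ENNReal.ofReal (b u) * innerNorm r p w f u := by
  have hq := hb.exponent_pos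
  obtain ⟨C, hC⟩ := exists_gammaNorm_le_add (μ := μ) hr hq p b w
  obtain ⟨C₁, hC₁⟩ := exists_logNorm_Ioc_innerNorm_le (μ := μ) hr hq hp hb.potter hw
  obtain ⟨C₂, hC₂⟩ := hb.exists_le_tailENorm
  obtain ⟨C₃, hC₃⟩ := exists_rearrangement_le_innerNorm (μ := μ) hr p hw
  refine ⟨C * (C₁ * C₂ * C₃ + 1), fun f g t ht hgf hgt hfin => ?_⟩
  lift rearrangement f t to ℝ≥0 using hfin with a ha
  set R := logNorm q (Ioi t) fun u => ENNReal.ofReal (b u) * innerNorm r p w f u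
  have head : logNorm q (Ioc 0 t) (fun u => ENNReal.ofReal (b u) * innerNorm r p w g u) ≤
      C₁ * C₂ * C₃ * R := by
    calc _ ≤ C₁ * ENNReal.ofReal (b t) * (ENNReal.ofReal (t ^ (1 / p) * w t) * a) :=
          hC₁ g a hgt t ht
      _ ≤ C₁ * (C₂ * tailENorm q b t) * (C₃ * innerNorm r p w f t) := by
          gcongr ?_ * ?_
          · gcongr
            exact hC₂ t ht
          · rw [ha]
            exact hC₃ f t ht
      _ = C₁ * C₂ * C₃ * (tailENorm q b t * innerNorm r p w f t) := by ring
      _ ≤ C₁ * C₂ * C₃ * R := by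
          gcongr
          exact tailENorm_mul_le_logNorm hq ht.le b (innerNorm_monotone hr f)
  have tail : logNorm q (Ioi t) (fun u => ENNReal.ofReal (b u) * innerNorm r p w g u) ≤ R :=
    logNorm_mono hq measurableSet_Ioi fun u _ => by gcongr; exact innerNorm_mono hr hgf u
  calc gammaNorm r q p b w g ≤ C * (C₁ * C₂ * C₃ * R + R) :=
        (hC g t ht).trans (by gcongr)
    _ = _ := by push_cast; ring

end GammaNorm

section KFunctional

variable {V : Type*} [AddCommGroup V] {N₀ N₁ : V → ℝ≥0∞} {s t : ℝ} {f : V}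

theorem kFunctional_le (hs : 0 < s) {f₀ f₁ : V} (hf : f = f₀ + f₁) :
    kFunctional N₀ N₁ s f ≤ N₀ f₀ + ENNReal.ofReal s * N₁ f₁ := by
  rcases eq_or_ne (N₀ f₀) ∞ with h₀ | h₀
  · simp only [h₀, top_add, le_top]
  rcases eq_or_ne (N₁ f₁) ∞ with h₁ | h₁
  · rw [h₁, ENNReal.mul_top (ENNReal.ofReal_pos.2 hs).ne', add_top]
    exact le_top
  exact iInf₂_le_of_le f₀ (lt_top_iff_ne_top.2 h₀)
    (iInf₂_le_of_le f₁ (lt_top_iff_ne_top.2 h₁) (iInf_le _ hf))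

theorem le_mul_kFunctional {a : ℝ≥0∞} {C : ℝ≥0}
    (h : ∀ f₀ f₁, f = f₀ + f₁ → a ≤ C * (N₀ f₀ + ENNReal.ofReal s * N₁ f₁)) :
    a ≤ C * kFunctional N₀ N₁ s f := by
  rcases eq_or_ne C 0 with rfl | hC
  · simpa using h f 0 (add_zero f).symm
  have hC' : (C : ℝ≥0∞) ≠ 0 := ENNReal.coe_ne_zero.2 hC
  rw [← ENNReal.div_le_iff' hC' ENNReal.coe_ne_top]
  refine le_iInf₂ fun f₀ _ => le_iInf₂ fun f₁ _ => le_iInf fun hf => ?_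
  exact (ENNReal.div_le_iff' hC' ENNReal.coe_ne_top).2 (h f₀ f₁ hf)

theorem kFunctional_mono : Monotone fun t => kFunctional N₀ N₁ t f := fun _ _ hst => by
  dsimp only [kFunctional]
  gcongr

theorem kFunctional_le_mul (hs : 0 < s) (hst : s ≤ t) :
    kFunctional N₀ N₁ t f ≤ (t / s).toNNReal * kFunctional N₀ N₁ s f := by
  refine le_mul_kFunctional fun f₀ f₁ hf => (kFunctional_le (hs.trans_le hst) hf).trans ?_
  have hone : 1 ≤ ENNReal.ofReal (t / s) := ENNReal.one_le_ofReal.2 ((one_le_div hs).2 hst)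
  rw [← ENNReal.ofReal, mul_add, ← mul_assoc, ← ENNReal.ofReal_mul' hs.le,
    div_mul_cancel₀ t hs.ne']
  gcongr
  exact le_mul_of_one_le_left' hone

theorem mem_sumSet_of_kFunctional_lt_top (h : kFunctional N₀ N₁ s f < ∞) :
    f ∈ sumSet N₀ N₁ := by
  simp only [kFunctional, iInf_lt_iff] at h
  obtain ⟨f₀, h₀, f₁, h₁, hf, -⟩ := h
  exact ⟨f₀, h₀, f₁, h₁, hf⟩

end KFunctional

section KEstimate

variable {Ω : Type*} [MeasurableSpace Ω] {μ : Measure Ω} {q₀ q₁ r p : ℝ} {b₀ b₁ w : ℝ → ℝ}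

theorem ofReal_rho_mul_tailENorm (h₀ : TailWeight q₀ b₀) (h₁ : TailWeight q₁ b₁) {t : ℝ}
    (ht : 0 < t) :
    ENNReal.ofReal (rho q₀ q₁ b₀ b₁ t) * tailENorm q₁ b₁ t = tailENorm q₀ b₀ t := by
  rw [← h₁.ofReal_tailNorm ht, ← h₀.ofReal_tailNorm ht,
    ← ENNReal.ofReal_mul (rho_pos h₀ h₁ ht).le, rho_mul_tailNorm h₁ ht]

/-- Truncating `f` at the height `f^*(t)` gives a nearly optimal decomposition for `K(ρ(t), f)`. -/
theorem exists_kFunctional_rho_le (h₀ : TailWeight q₀ b₀) (h₁ : TailWeight q₁ b₁) (hr : 0 < r)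
    (hp : 0 < p) (hw : Potter w) : ∃ C : ℝ≥0, ∀ (f : Ω →ₘ[μ] ℝ) (t : ℝ), 0 < t →
      kFunctional (gammaNorm r q₀ p b₀ w) (gammaNorm r q₁ p b₁ w) (rho q₀ q₁ b₀ b₁ t) f ≤
        C * (logNorm q₀ (Ioc 0 t) (fun u => ENNReal.ofReal (b₀ u) * innerNorm r p w f u) +
          ENNReal.ofReal (rho q₀ q₁ b₀ b₁ t) *
            logNorm q₁ (Ioi t) fun u => ENNReal.ofReal (b₁ u) * innerNorm r p w f u) := by
  obtain ⟨C₀, hC₀⟩ := exists_gammaNorm_sub_truncate_le (μ := μ) hr h₀.exponent_pos p b₀ w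
  obtain ⟨C₁, hC₁⟩ := exists_gammaNorm_le_of_rearrangement_le (μ := μ) hr hp h₁ hw
  refine ⟨C₀ + C₁ + 1, fun f t ht => ?_⟩
  have hρ := ENNReal.ofReal_pos.2 (rho_pos h₀ h₁ ht)
  set head := logNorm q₀ (Ioc 0 t) fun u => ENNReal.ofReal (b₀ u) * innerNorm r p w f u
  set tail := logNorm q₁ (Ioi t) fun u => ENNReal.ofReal (b₁ u) * innerNorm r p w f u
  set ρ := rho q₀ q₁ b₀ b₁ t
  have le_tail : tailENorm q₁ b₁ t * innerNorm r p w f t ≤ tail :=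
    tailENorm_mul_le_logNorm h₁.exponent_pos ht.le b₁ (innerNorm_monotone hr f)
  rcases eq_or_ne (innerNorm r p w f t) ∞ with htop | hfin
  · rw [htop, ENNReal.mul_top, top_le_iff] at le_tail
    · rw [le_tail, ENNReal.mul_top hρ.ne', add_top, ENNReal.mul_top (by positivity)]
      exact le_top
    · rw [← h₁.ofReal_tailNorm ht]
      exact (ENNReal.ofReal_pos.2 (h₁.tailNorm_pos ht)).ne'
  have hfin' := rearrangement_ne_top_of_innerNorm_ne_top hr hw ht hfin
  set c := (rearrangement f t).toReal
  have hc : 0 ≤ c := ENNReal.toReal_nonneg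
  have hcf : ENNReal.ofReal c = rearrangement f t := ENNReal.ofReal_toReal hfin'
  have bound₀ : gammaNorm r q₀ p b₀ w (f - truncate c f) ≤
      C₀ * (head + ENNReal.ofReal ρ * tail) := by
    refine (hC₀ f t c ht hc hcf.ge hfin).trans ?_
    rw [← ofReal_rho_mul_tailENorm h₀ h₁ ht, mul_assoc]
    gcongr
  have bound₁ : gammaNorm r q₁ p b₁ w (truncate c f) ≤ C₁ * tail :=
    hC₁ f _ t ht (rearrangement_truncate_le hc f)
      (fun τ => (rearrangement_truncate_le_height hc f τ).trans hcf.le) hfin'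
  calc kFunctional (gammaNorm r q₀ p b₀ w) (gammaNorm r q₁ p b₁ w) ρ f
      ≤ C₀ * (head + ENNReal.ofReal ρ * tail) + ENNReal.ofReal ρ * (C₁ * tail) :=
        (kFunctional_le (rho_pos h₀ h₁ ht) (sub_add_cancel f (truncate c f)).symm).trans
          (by gcongr)
    _ ≤ C₀ * (head + ENNReal.ofReal ρ * tail) + C₁ * (head + ENNReal.ofReal ρ * tail) := by
        rw [mul_left_comm]
        gcongr
        exact le_add_self
    _ ≤ _ := by
        rw [← add_mul]
        gcongr
        push_cast
        exact le_self_add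

theorem exists_tailENorm_mul_le_kFunctional_rho (h₀ : TailWeight q₀ b₀) (h₁ : TailWeight q₁ b₁)
    (hr : 0 < r) (p : ℝ) (hw : IsSV w) : ∃ C : ℝ≥0, ∀ (f : Ω →ₘ[μ] ℝ) (t : ℝ), 0 < t →
      tailENorm q₀ b₀ t * innerNorm r p w f t ≤
        C * kFunctional (gammaNorm r q₀ p b₀ w) (gammaNorm r q₁ p b₁ w)
          (rho q₀ q₁ b₀ b₁ t) f := by
  obtain ⟨C, hC⟩ := exists_innerNorm_add_le (μ := μ) hr p hw
  refine ⟨C, fun f t ht => le_mul_kFunctional fun f₀ f₁ hf => ?_⟩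
  calc tailENorm q₀ b₀ t * innerNorm r p w f t
      ≤ tailENorm q₀ b₀ t * (C * (innerNorm r p w f₀ t + innerNorm r p w f₁ t)) := by
        rw [hf]
        gcongr
        exact hC f₀ f₁ t ht.le
    _ = C * (tailENorm q₀ b₀ t * innerNorm r p w f₀ t +
          ENNReal.ofReal (rho q₀ q₁ b₀ b₁ t) * (tailENorm q₁ b₁ t * innerNorm r p w f₁ t)) := by
        rw [← mul_assoc (ENNReal.ofReal _), ofReal_rho_mul_tailENorm h₀ h₁ ht]
        ring
    _ ≤ _ := by
        gcongr
        · exact tailENorm_mul_innerNorm_le_gammaNorm hr h₀.exponent_pos p b₀ w f₀ ht.le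
        · exact tailENorm_mul_innerNorm_le_gammaNorm hr h₁.exponent_pos p b₁ w f₁ ht.le

end KEstimate

/-! ### Sequence spaces and discretization -/

/-- The `ℓ^q` quasi-norm `(∑_k a_k^q)^{1/q}` of a sequence indexed by `ℤ`. -/
def seqNorm (q : ℝ) (a : ℤ → ℝ≥0∞) : ℝ≥0∞ :=
  (∑' k, a k ^ q) ^ (1 / q)

section SeqNorm

variable {q : ℝ} {a b : ℤ → ℝ≥0∞}

theorem seqNorm_mono (hq : 0 < q) (hab : ∀ k, a k ≤ b k) : seqNorm q a ≤ seqNorm q b := by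
  unfold seqNorm
  gcongr
  exact hab _

theorem seqNorm_const_mul (hq : 0 < q) (c : ℝ≥0∞) (a : ℤ → ℝ≥0∞) :
    seqNorm q (fun k => c * a k) = c * seqNorm q a := by
  simp only [seqNorm, ENNReal.mul_rpow_of_nonneg _ _ hq.le]
  rw [ENNReal.tsum_mul_left, ENNReal.mul_rpow_of_nonneg _ _ (one_div_nonneg.2 hq.le),
    ← ENNReal.rpow_mul, mul_one_div_cancel hq.ne', ENNReal.rpow_one]

theorem seqNorm_le_const_mul (hq : 0 < q) {c : ℝ≥0∞} (hab : ∀ k, a k ≤ c * b k) :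
    seqNorm q a ≤ c * seqNorm q b :=
  (seqNorm_mono hq hab).trans_eq (seqNorm_const_mul hq c b)

theorem seqNorm_comp_add (q : ℝ) (a : ℤ → ℝ≥0∞) (m : ℤ) :
    seqNorm q (fun k => a (k + m)) = seqNorm q a :=
  congrArg (· ^ (1 / q)) ((Equiv.addRight m).tsum_eq fun k => a k ^ q)

theorem exists_seqNorm_add_le (hq : 0 < q) : ∃ C : ℝ≥0, ∀ a b : ℤ → ℝ≥0∞,
    seqNorm q (fun k => a k + b k) ≤ C * (seqNorm q a + seqNorm q b) := by
  obtain ⟨C, hC⟩ := exists_add_rpow_le hq.le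
  obtain ⟨C', hC'⟩ := exists_add_rpow_le (one_div_nonneg.2 hq.le)
  refine ⟨C ^ (1 / q) * C', fun a b => ?_⟩
  calc seqNorm q (fun k => a k + b k)
      ≤ (∑' k, C * (a k ^ q + b k ^ q)) ^ (1 / q) := by
        unfold seqNorm
        gcongr
        exact hC _ _
    _ = C ^ (1 / q) * (∑' k, a k ^ q + ∑' k, b k ^ q) ^ (1 / q) := by
        rw [ENNReal.tsum_mul_left, ENNReal.tsum_add,
          ENNReal.mul_rpow_of_nonneg _ _ (one_div_nonneg.2 hq.le)]
    _ ≤ C ^ (1 / q) * (C' * (seqNorm q a + seqNorm q b)) := by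
        gcongr
        exact hC' _ _
    _ = _ := by
        rw [ENNReal.coe_mul, ENNReal.coe_rpow_of_nonneg _ (one_div_nonneg.2 hq.le), mul_assoc]

end SeqNorm

section Hardy

variable {p q : ℝ}

theorem tsum_geometric_mul_const_rpow (hp : 0 < p) (β c : ℝ≥0∞) :
    (∑' n : ℕ, (β ^ n * c) ^ p) ^ (1 / p) = ((1 - β ^ p)⁻¹) ^ (1 / p) * c := by
  have hterm (n : ℕ) : (β ^ n * c) ^ p = (β ^ p) ^ n * c ^ p := by
    rw [ENNReal.mul_rpow_of_nonneg _ _ hp.le, ← ENNReal.rpow_natCast_mul, mul_comm (n : ℝ),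
      ENNReal.rpow_mul_natCast]
  simp only [hterm]
  rw [ENNReal.tsum_mul_right, ENNReal.tsum_geometric,
    ENNReal.mul_rpow_of_nonneg _ _ (one_div_nonneg.2 hp.le), ← ENNReal.rpow_mul,
    mul_one_div_cancel hp.ne', ENNReal.rpow_one]

theorem inv_one_sub_rpow_ne_top (hp : 0 < p) {β : ℝ≥0∞} (hβ : β < 1) :
    (1 - β ^ p)⁻¹ ^ (1 / p) ≠ ∞ :=
  ENNReal.rpow_ne_top_of_nonneg (one_div_nonneg.2 hp.le) <|
    ENNReal.inv_ne_top.2 (tsub_pos_of_lt (ENNReal.rpow_lt_one hβ hp)).ne'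

theorem tsum_geometric_mul_rpow_le (hp : 0 < p) (hq : 0 < q) (β : ℝ≥0∞) (y : ℕ → ℝ≥0∞) :
    (∑' n, (β ^ n * y n) ^ p) ^ (1 / p) ≤
      ((1 - β ^ p)⁻¹) ^ (1 / p) * (∑' n, y n ^ q) ^ (1 / q) := by
  rw [← tsum_geometric_mul_const_rpow hp]
  gcongr with n
  rw [← ENNReal.rpow_le_rpow_iff hq, ← ENNReal.rpow_mul, one_div_mul_cancel hq.ne',
    ENNReal.rpow_one]
  exact ENNReal.le_tsum n

theorem exists_seqNorm_tsum_le (hp : 0 < p) (hq : 0 < q) {β : ℝ≥0∞} (hβ : β < 1) :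
    ∃ C : ℝ≥0, ∀ (y : ℤ → ℝ≥0∞) (e : ℤ),
      seqNorm q (fun k => (∑' n : ℕ, (β ^ n * (β ^ n * y (k + e * n))) ^ p) ^ (1 / p)) ≤
        C * seqNorm q y := by
  refine ⟨((1 - β ^ p)⁻¹ ^ (1 / p)).toNNReal * ((1 - β ^ q)⁻¹ ^ (1 / q)).toNNReal,
    fun y e => ?_⟩
  rw [ENNReal.coe_mul, ENNReal.coe_toNNReal (inv_one_sub_rpow_ne_top hp hβ),
    ENNReal.coe_toNNReal (inv_one_sub_rpow_ne_top hq hβ), mul_assoc]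
  refine (seqNorm_le_const_mul hq
    (b := fun k => (∑' n : ℕ, (β ^ n * y (k + e * n)) ^ q) ^ (1 / q))
    fun k => tsum_geometric_mul_rpow_le hp hq β _).trans ?_
  gcongr
  have inner_sum (n : ℕ) :
      ∑' k, (β ^ n * y (k + e * n)) ^ q = (β ^ q) ^ n * ∑' k, y k ^ q := by
    simp only [ENNReal.mul_rpow_of_nonneg _ _ hq.le]
    rw [ENNReal.tsum_mul_left, ← ENNReal.rpow_natCast_mul, mul_comm (n : ℝ),
      ENNReal.rpow_mul_natCast]
    exact congrArg _ ((Equiv.addRight (e * n)).tsum_eq fun k => y k ^ q)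
  simp only [seqNorm, ← ENNReal.rpow_mul, one_div_mul_cancel hq.ne', ENNReal.rpow_one]
  rw [ENNReal.tsum_comm]
  simp only [inner_sum]
  rw [ENNReal.tsum_mul_right, ENNReal.tsum_geometric,
    ENNReal.mul_rpow_of_nonneg _ _ (one_div_nonneg.2 hq.le)]

/-- The discrete Hardy inequality; `e = ±1` selects sums over the future or over the past. -/
theorem exists_seqNorm_mul_tsum_le (hp : 0 < p) (hq : 0 < q) {V W : ℤ → ℝ≥0∞} {C γ : ℝ≥0}
    (hγ : γ < 1) {e : ℤ} (hVW : ∀ k (n : ℕ), V k ≤ C * γ ^ n * W (k + e * n)) :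
    ∃ C' : ℝ≥0, ∀ a : ℤ → ℝ≥0∞,
      seqNorm q (fun k => V k * (∑' n : ℕ, a (k + e * n) ^ p) ^ (1 / p)) ≤
        C' * seqNorm q fun k => W k * a k := by
  have hβ : NNReal.sqrt γ < 1 := by simpa only [NNReal.sqrt_one] using NNReal.sqrt_lt_sqrt.2 hγ
  obtain ⟨C', hC'⟩ := exists_seqNorm_tsum_le hp hq (ENNReal.coe_lt_one_iff.2 hβ)
  refine ⟨C * C', fun a => ?_⟩
  rw [ENNReal.coe_mul, mul_assoc]
  refine (seqNorm_le_const_mul hq fun k => ?_).trans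
    (mul_le_mul_right (hC' (fun k => W k * a k) e) _)
  have pointwise (n : ℕ) : V k * a (k + e * n) ≤
      C * (NNReal.sqrt γ ^ n * (NNReal.sqrt γ ^ n * (W (k + e * n) * a (k + e * n)))) :=
    calc V k * a (k + e * n)
        ≤ C * γ ^ n * W (k + e * n) * a (k + e * n) := by
          gcongr
          exact hVW k n
      _ = _ := by
          nth_rw 1 [← NNReal.mul_self_sqrt γ]
          rw [ENNReal.coe_mul, mul_pow]
          ring
  have hpow (x : ℝ≥0∞) : (x ^ p) ^ (1 / p) = x := by
    rw [← ENNReal.rpow_mul, mul_one_div_cancel hp.ne', ENNReal.rpow_one]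
  calc V k * (∑' n : ℕ, a (k + e * n) ^ p) ^ (1 / p)
      = (∑' n : ℕ, (V k * a (k + e * n)) ^ p) ^ (1 / p) := by
        simp only [ENNReal.mul_rpow_of_nonneg _ _ hp.le]
        rw [ENNReal.tsum_mul_left, ENNReal.mul_rpow_of_nonneg _ _ (one_div_nonneg.2 hp.le), hpow]
    _ ≤ (∑' n : ℕ, (C * (NNReal.sqrt γ ^ n * (NNReal.sqrt γ ^ n *
          (W (k + e * n) * a (k + e * n))))) ^ p) ^ (1 / p) := by
        gcongr (∑' n, ?_ ^ p) ^ (1 / p) with n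
        exact pointwise n
    _ = _ := by
        simp only [ENNReal.mul_rpow_of_nonneg (C : ℝ≥0∞) _ hp.le]
        rw [ENNReal.tsum_mul_left, ENNReal.mul_rpow_of_nonneg _ _ (one_div_nonneg.2 hp.le), hpow]

end Hardy

section Discretization

variable {t : ℤ → ℝ} {q : ℝ}

namespace IsPartition

theorem exists_mem_Ioc (ht : IsPartition t) {x : ℝ} (hx : 0 < x) :
    ∃ k, x ∈ Ioc (t k) (t (k + 1)) := by
  obtain ⟨m, hm⟩ := ht.exists_ge x
  obtain ⟨k, hk, hkmax⟩ := Int.exists_greatest_of_bdd (P := fun k => t k < x)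
    ⟨m, fun z hz => (ht.monotone.reflect_lt (hz.trans_le hm)).le⟩ (ht.exists_lt x hx)
  exact ⟨k, hk, not_lt.1 fun h => (Int.lt_succ k).not_ge (hkmax (k + 1) h)⟩

theorem logNorm_Ioi_eq_seqNorm (ht : IsPartition t) (hq : 0 < q) (G : ℝ → ℝ≥0∞) :
    logNorm q (Ioi 0) G = seqNorm q fun k => logNorm q (Ioc (t k) (t (k + 1))) G := by
  have hU : Ioi (0 : ℝ) = ⋃ k, Ioc (t k) (t (k + 1)) := by
    ext x
    rw [mem_iUnion]
    exact ⟨ht.exists_mem_Ioc, fun ⟨k, hk⟩ => (ht.pos k).trans hk.1⟩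
  simp only [seqNorm, logNorm_rpow_self hq]
  rw [logNorm, hU]
  exact congrArg (· ^ (1 / q)) (lintegral_iUnion (fun _ => measurableSet_Ioc)
    ht.monotone.pairwise_disjoint_on_Ioc_succ _)

theorem logNorm_Ioi_le (ht : IsPartition t) (hq : 0 < q) (G : ℝ → ℝ≥0∞) (k : ℤ) :
    logNorm q (Ioi (t k)) G ≤
      (∑' n : ℕ, logNorm q (Ioc (t (k + 1 * n)) (t (k + 1 * n + 1))) G ^ q) ^ (1 / q) := by
  simp only [logNorm_rpow_self hq]
  unfold logNorm
  gcongr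
  refine le_trans (lintegral_mono_set fun x hx => ?_) (lintegral_iUnion_le _ _)
  obtain ⟨j, hj⟩ := ht.exists_mem_Ioc ((ht.pos k).trans hx)
  obtain ⟨n, rfl⟩ := Int.le.dest (Int.lt_add_one_iff.1 (ht.monotone.reflect_lt (hx.trans_le hj.2)))
  exact mem_iUnion.2 ⟨n, by simpa only [one_mul] using hj⟩

theorem logNorm_Ioc_zero_le (ht : IsPartition t) (hq : 0 < q) (G : ℝ → ℝ≥0∞) (k : ℤ) :
    logNorm q (Ioc 0 (t k)) G ≤
      (∑' n : ℕ, logNorm q (Ioc (t (k + -1 * n - 1)) (t (k + -1 * n))) G ^ q) ^ (1 / q) := by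
  simp only [logNorm_rpow_self hq]
  unfold logNorm
  gcongr
  refine le_trans (lintegral_mono_set fun x hx => ?_) (lintegral_iUnion_le _ _)
  obtain ⟨j, hj⟩ := ht.exists_mem_Ioc hx.1
  obtain ⟨n, hn⟩ := Int.le.dest (Int.add_one_le_iff.2 (ht.monotone.reflect_lt (hj.1.trans_le hx.2)))
  have hkn : k + -1 * (n : ℤ) = j + 1 := by omega
  refine mem_iUnion.2 ⟨n, ?_⟩
  simpa only [hkn, add_sub_cancel_right] using hj

theorem seqNorm_le_logNorm (ht : IsPartition t) (hq : 0 < q) {C : ℝ≥0∞} {v F : ℝ → ℝ≥0∞}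
    {V : ℤ → ℝ≥0∞} (hF : Monotone F) (hV : ∀ k, V k ≤ C * logNorm q (Ioc (t k) (t (k + 1))) v) :
    seqNorm q (fun k => V k * F (t k)) ≤ C * logNorm q (Ioi 0) fun u => v u * F u := by
  rw [ht.logNorm_Ioi_eq_seqNorm hq]
  refine seqNorm_le_const_mul hq fun k => ?_
  calc V k * F (t k)
      ≤ C * logNorm q (Ioc (t k) (t (k + 1))) v * F (t k) := by
        gcongr
        exact hV k
    _ ≤ C * logNorm q (Ioc (t k) (t (k + 1))) fun u => v u * F u := by
        rw [mul_assoc]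
        gcongr
        exact logNorm_mul_le_logNorm_mul hq measurableSet_Ioc v fun u hu => hF hu.1.le

theorem logNorm_le_seqNorm (ht : IsPartition t) (hq : 0 < q) {C : ℝ≥0∞} {v F : ℝ → ℝ≥0∞}
    {V : ℤ → ℝ≥0∞} (hF : Monotone F) (hC : C ≠ 0) (hV₀ : ∀ k, V k ≠ 0)
    (hV : ∀ k, logNorm q (Ioc (t k) (t (k + 1))) v ≤ C * V k) :
    logNorm q (Ioi 0) (fun u => v u * F u) ≤ C * seqNorm q fun k => V k * F (t (k + 1)) := by
  rw [ht.logNorm_Ioi_eq_seqNorm hq]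
  refine seqNorm_le_const_mul hq fun k => ?_
  rw [← mul_assoc]
  exact logNorm_Ioc_mul_le hq hF (mul_ne_zero hC (hV₀ k)) (hV k)

end IsPartition

end Discretization

/-! ### Discretization of the interpolation quasi-norm -/

section InterpNorm

variable {V : Type*} [AddCommGroup V] (N₀ N₁ : V → ℝ≥0∞) {q : ℝ} {b : ℝ → ℝ} (θ : ℝ)

theorem interpNorm_eq_logNorm (hq : 0 < q) (b : ℝ → ℝ) (f : V) : interpNorm N₀ N₁ θ q b f =
    logNorm q (Ioi 0) fun s => ENNReal.ofReal (s ^ (-θ) * b s) * kFunctional N₀ N₁ s f :=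
  lqNorm_eq_logNorm hq measurableSet_Ioi subset_rfl (-θ) b fun s => kFunctional N₀ N₁ s f

theorem exists_mul_kFunctional_le_interpNorm (hq : 0 < q) (hb : Doubling b) :
    ∃ C : ℝ≥0, ∀ (f : V) (s : ℝ), 0 < s →
      ENNReal.ofReal (s ^ (-θ) * b s) * kFunctional N₀ N₁ s f ≤ C * interpNorm N₀ N₁ θ q b f := by
  obtain ⟨C, hC⟩ := (hb.rpow_mul (-θ)).exists_le_logNorm_Ioo hq
  refine ⟨C, fun f s hs => ?_⟩
  calc ENNReal.ofReal (s ^ (-θ) * b s) * kFunctional N₀ N₁ s f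
      ≤ C * logNorm q (Ioo s (2 * s)) (fun u => ENNReal.ofReal (u ^ (-θ) * b u)) *
          kFunctional N₀ N₁ s f := by
        gcongr
        exact hC s s hs ⟨le_rfl, by linarith⟩
    _ ≤ C * logNorm q (Ioo s (2 * s))
          fun u => ENNReal.ofReal (u ^ (-θ) * b u) * kFunctional N₀ N₁ u f := by
        rw [mul_assoc]
        gcongr
        exact logNorm_mul_le_logNorm_mul hq measurableSet_Ioo _ fun u hu => kFunctional_mono hu.1.le
    _ ≤ C * interpNorm N₀ N₁ θ q b f := by
        rw [interpNorm_eq_logNorm N₀ N₁ θ hq]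
        gcongr
        exact logNorm_mono_set hq fun u hu => hs.trans hu.1

theorem interpSpace_eq_finiteSet (hq : 0 < q) (hb : Doubling b) :
    interpSpace N₀ N₁ θ q b = finiteSet (interpNorm N₀ N₁ θ q b) := by
  obtain ⟨C, hC⟩ := exists_mul_kFunctional_le_interpNorm N₀ N₁ θ hq hb
  refine Subset.antisymm (fun f hf => hf.2) fun f hf => ⟨?_, hf⟩
  refine mem_sumSet_of_kFunctional_lt_top (s := 1) (ENNReal.lt_top_of_mul_ne_top_right
    ((hC f 1 one_pos).trans_lt (ENNReal.mul_lt_top ENNReal.coe_lt_top hf)).ne ?_)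
  rw [Real.one_rpow, one_mul]
  exact (ENNReal.ofReal_pos.2 (hb.pos one_pos)).ne'

variable {x : ℤ → ℝ}

theorem exists_seqNorm_le_interpNorm (hq : 0 < q) (hb : Doubling b) (hpos : ∀ k, 0 < x k)
    (hx : ∀ k, 2 * x k ≤ x (k + 1)) : ∃ C : ℝ≥0, ∀ f : V,
      seqNorm q (fun k => ENNReal.ofReal (x k ^ (-θ) * b (x k)) * kFunctional N₀ N₁ (x k) f) ≤
        C * interpNorm N₀ N₁ θ q b f := by
  obtain ⟨C, hC⟩ := (hb.rpow_mul (-θ)).exists_le_logNorm_Ioo hq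
  refine ⟨C, fun f => ?_⟩
  rw [interpNorm_eq_logNorm N₀ N₁ θ hq]
  refine (IsPartition.of_two_mul_le hpos hx).seqNorm_le_logNorm hq kFunctional_mono fun k => ?_
  refine (hC (x k) (x k) (hpos k) ⟨le_rfl, by linarith [hpos k]⟩).trans ?_
  gcongr
  exact logNorm_mono_set hq fun u hu => ⟨hu.1, hu.2.le.trans (hx k)⟩

theorem exists_interpNorm_le_seqNorm (hq : 0 < q) (hb : Doubling b) (hx : IsPartition x)
    {D : ℝ} (hD : ∀ k, x (k + 1) ≤ D * x k) : ∃ C : ℝ≥0, ∀ f : V,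
      interpNorm N₀ N₁ θ q b f ≤ C * seqNorm q fun k =>
        ENNReal.ofReal (x k ^ (-θ) * b (x k)) * kFunctional N₀ N₁ (x k) f := by
  have hD₁ : 1 ≤ D := one_le_of_le_mul_right₀ (hx.pos 0)
    ((hx.monotone ((Int.lt_succ 0).le)).trans (hD 0))
  have hκ := hb.rpow_mul (-θ)
  obtain ⟨C, hCpos, hC⟩ := hκ.exists_logNorm_Ioc_le hq hD₁
  refine ⟨C * D.toNNReal, fun f => ?_⟩
  rw [interpNorm_eq_logNorm N₀ N₁ θ hq]
  refine (hx.logNorm_le_seqNorm hq kFunctional_mono (ENNReal.coe_ne_zero.2 hCpos.ne')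
    (fun k => (ENNReal.ofReal_pos.2 (hκ.pos (hx.pos k))).ne')
    fun k => hC _ _ (hx.pos k) (hD k)).trans ?_
  rw [ENNReal.coe_mul, mul_assoc]
  gcongr
  refine seqNorm_le_const_mul hq fun k => ?_
  rw [mul_left_comm]
  gcongr
  refine (kFunctional_le_mul (hx.pos k) (hx.monotone ((Int.lt_succ k).le))).trans ?_
  gcongr
  exact (div_le_iff₀ (hx.pos k)).2 (hD k)

end InterpNorm

/-! ### Discrete Hardy estimates for the grid weight -/

/-- The weight `ρ(u)^{-θ} b(ρ(u)) ‖u^{-1/q₀} b₀(u)‖_{q₀,(u,∞)}`. Both quasi-norms of the theorem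
are discretized through its values on a grid. -/
def gridWeight (q₀ q₁ θ : ℝ) (b₀ b₁ b : ℝ → ℝ) (u : ℝ) : ℝ :=
  rho q₀ q₁ b₀ b₁ u ^ (-θ) * b (rho q₀ q₁ b₀ b₁ u) * tailNorm q₀ b₀ u

section Grid

variable {q₀ q₁ q r p θ M : ℝ} {b₀ b₁ b w : ℝ → ℝ} {t : ℤ → ℝ}

local notation "ρ" => rho q₀ q₁ b₀ b₁

theorem ofReal_gridWeight (h₀ : TailWeight q₀ b₀) (θ : ℝ) (b : ℝ → ℝ) {u : ℝ} (hu : 0 < u) :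
    ENNReal.ofReal (gridWeight q₀ q₁ θ b₀ b₁ b u) =
      ENNReal.ofReal (ρ u ^ (-θ) * b (ρ u)) * tailENorm q₀ b₀ u := by
  rw [gridWeight, ENNReal.ofReal_mul' (h₀.tailNorm_pos hu).le, h₀.ofReal_tailNorm hu]

theorem ofReal_gridWeight_eq_mul_tailENorm (h₀ : TailWeight q₀ b₀) (h₁ : TailWeight q₁ b₁)
    (θ : ℝ) (b : ℝ → ℝ) {u : ℝ} (hu : 0 < u) :
    ENNReal.ofReal (gridWeight q₀ q₁ θ b₀ b₁ b u) =
      ENNReal.ofReal (ρ u ^ (1 - θ) * b (ρ u)) * tailENorm q₁ b₁ u := by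
  have hρ := rho_pos h₀ h₁ hu
  rw [ofReal_gridWeight h₀ θ b hu, ← ofReal_rho_mul_tailENorm h₀ h₁ hu, ← mul_assoc,
    ← ENNReal.ofReal_mul' hρ.le, sub_eq_neg_add, Real.rpow_add hρ, Real.rpow_one, mul_right_comm]

theorem gridWeight_pos (h₀ : TailWeight q₀ b₀) (h₁ : TailWeight q₁ b₁) (θ : ℝ) (hb : Potter b)
    {u : ℝ} (hu : 0 < u) : 0 < gridWeight q₀ q₁ θ b₀ b₁ b u := by
  have hρ := rho_pos h₀ h₁ hu
  exact mul_pos (mul_pos (Real.rpow_pos_of_pos hρ _) (hb.pos hρ)) (h₀.tailNorm_pos hu)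

namespace IsGrid

theorem two_pow_mul_rho_le (ht : IsGrid q₀ q₁ b₀ b₁ M t) (k : ℤ) (n : ℕ) :
    2 ^ n * ρ (t k) ≤ ρ (t (k + n)) :=
  two_pow_mul_le (x := fun k => ρ (t k)) ht.two_mul_rho_le k n

theorem isPartition_rho (ht : IsGrid q₀ q₁ b₀ b₁ M t) (h₀ : TailWeight q₀ b₀)
    (h₁ : TailWeight q₁ b₁) : IsPartition fun k => ρ (t k) :=
  .of_two_mul_le (fun k => rho_pos h₀ h₁ (ht.pos k)) ht.two_mul_rho_le

theorem tailNorm_zero_le (ht : IsGrid q₀ q₁ b₀ b₁ M t) (h₀ : TailWeight q₀ b₀)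
    (h₁ : TailWeight q₁ b₁) (k : ℤ) :
    tailNorm q₀ b₀ (t k) ≤ M * tailNorm q₀ b₀ (t (k + 1)) := by
  have hM : 0 < M := two_pos.trans_le ht.two_le
  have hA₁ := h₁.tailNorm_pos (ht.pos (k + 1))
  calc tailNorm q₀ b₀ (t k) = M * (ρ (t k) * tailNorm q₁ b₁ (t (k + 1))) := by
        rw [← rho_mul_tailNorm (q₀ := q₀) (b₀ := b₀) h₁ (ht.pos k), ht.tailNorm_eq k]; ring
    _ ≤ M * (ρ (t (k + 1)) * tailNorm q₁ b₁ (t (k + 1))) := by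
        gcongr
        exact (ht.isPartition_rho h₀ h₁).monotone (Int.lt_succ k).le
    _ = M * tailNorm q₀ b₀ (t (k + 1)) := by rw [rho_mul_tailNorm h₁ (ht.pos (k + 1))]

theorem tailENorm_zero_le (ht : IsGrid q₀ q₁ b₀ b₁ M t) (h₀ : TailWeight q₀ b₀)
    (h₁ : TailWeight q₁ b₁) (k : ℤ) :
    tailENorm q₀ b₀ (t k) ≤ M.toNNReal * tailENorm q₀ b₀ (t (k + 1)) := by
  rw [← h₀.ofReal_tailNorm (ht.pos k), ← h₀.ofReal_tailNorm (ht.pos (k + 1)), ← ENNReal.ofReal,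
    ← ENNReal.ofReal_mul (two_pos.trans_le ht.two_le).le]
  exact ENNReal.ofReal_le_ofReal (ht.tailNorm_zero_le h₀ h₁ k)

theorem tailENorm_one_eq (ht : IsGrid q₀ q₁ b₀ b₁ M t) (h₁ : TailWeight q₁ b₁) (k : ℤ) :
    tailENorm q₁ b₁ (t k) = M.toNNReal * tailENorm q₁ b₁ (t (k + 1)) := by
  rw [← h₁.ofReal_tailNorm (ht.pos k), ← h₁.ofReal_tailNorm (ht.pos (k + 1)), ht.tailNorm_eq k,
    ENNReal.ofReal_mul (two_pos.trans_le ht.two_le).le, ENNReal.ofReal]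

theorem exists_seqNorm_logNorm_Ioc_zero_le (ht : IsGrid q₀ q₁ b₀ b₁ M t) (h₀ : TailWeight q₀ b₀)
    (h₁ : TailWeight q₁ b₁) (hq : 0 < q) (hθ : 0 < θ) (hb : Potter b) :
    ∃ C : ℝ≥0, ∀ F : ℝ → ℝ≥0∞, Monotone F →
      seqNorm q (fun k => ENNReal.ofReal (ρ (t k) ^ (-θ) * b (ρ (t k))) *
          logNorm q₀ (Ioc 0 (t k)) fun u => ENNReal.ofReal (b₀ u) * F u) ≤
        C * seqNorm q fun k => ENNReal.ofReal (gridWeight q₀ q₁ θ b₀ b₁ b (t k)) * F (t k) := by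
  obtain ⟨C, γ, hγ, hC⟩ := hb.exists_geometric_le hθ
  set V : ℤ → ℝ≥0∞ := fun k => ENNReal.ofReal (ρ (t k) ^ (-θ) * b (ρ (t k))) with hV
  have hdecay (k : ℤ) (n : ℕ) : V k ≤ C * γ ^ n * V (k + -1 * n) := by
    have h2 := ht.two_pow_mul_rho_le (k + -1 * n) n
    rw [neg_one_mul, neg_add_cancel_right] at h2
    rw [hV, neg_one_mul, ← ENNReal.coe_pow, ← ENNReal.coe_mul, ← ENNReal.ofReal_coe_nnreal,
      ← ENNReal.ofReal_mul (by positivity)]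
    exact ENNReal.ofReal_le_ofReal (hC n _ _ (rho_pos h₀ h₁ (ht.pos _)) h2).2
  obtain ⟨C', hC'⟩ := exists_seqNorm_mul_tsum_le h₀.exponent_pos hq hγ hdecay
  refine ⟨C' * M.toNNReal, fun F hF => ?_⟩
  have hblock (j : ℤ) :
      logNorm q₀ (Ioc (t (j - 1)) (t j)) (fun u => ENNReal.ofReal (b₀ u) * F u) ≤
        M.toNNReal * (tailENorm q₀ b₀ (t j) * F (t j)) := by
    refine (h₀.logNorm_Ioc_mul_le hF (ht.pos _) _).trans ?_
    rw [← mul_assoc]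
    gcongr
    simpa only [sub_add_cancel] using ht.tailENorm_zero_le h₀ h₁ (j - 1)
  refine (seqNorm_mono hq fun k => ?_).trans ((hC' fun j => M.toNNReal *
    (tailENorm q₀ b₀ (t j) * F (t j))).trans ?_)
  · gcongr
    refine (ht.logNorm_Ioc_zero_le h₀.exponent_pos _ k).trans ?_
    have := h₀.exponent_pos
    gcongr
    exact hblock _
  · rw [ENNReal.coe_mul, mul_assoc]
    gcongr
    refine seqNorm_le_const_mul hq fun k => ?_
    rw [ofReal_gridWeight h₀ θ b (ht.pos k), mul_left_comm, mul_assoc]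

theorem exists_seqNorm_logNorm_Ioi_le (ht : IsGrid q₀ q₁ b₀ b₁ M t) (h₀ : TailWeight q₀ b₀)
    (h₁ : TailWeight q₁ b₁) (hq : 0 < q) (hθ : θ < 1) (hb : Potter b) :
    ∃ C : ℝ≥0, ∀ F : ℝ → ℝ≥0∞, Monotone F →
      seqNorm q (fun k => ENNReal.ofReal (ρ (t k) ^ (1 - θ) * b (ρ (t k))) *
          logNorm q₁ (Ioi (t k)) fun u => ENNReal.ofReal (b₁ u) * F u) ≤
        C * seqNorm q fun k => ENNReal.ofReal (gridWeight q₀ q₁ θ b₀ b₁ b (t k)) * F (t k) := by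
  obtain ⟨C, γ, hγ, hC⟩ := hb.exists_geometric_le (sub_pos.2 hθ)
  set V : ℤ → ℝ≥0∞ := fun k => ENNReal.ofReal (ρ (t k) ^ (1 - θ) * b (ρ (t k))) with hV
  have hgrowth (k : ℤ) (n : ℕ) : V k ≤ C * γ ^ n * V (k + 1 * n + 1) := by
    rw [hV, one_mul, ← ENNReal.coe_pow, ← ENNReal.coe_mul, ← ENNReal.ofReal_coe_nnreal,
      ← ENNReal.ofReal_mul (by positivity)]
    exact ENNReal.ofReal_le_ofReal (hC n _ _ (rho_pos h₀ h₁ (ht.pos _))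
      ((ht.two_pow_mul_rho_le k n).trans
        ((ht.isPartition_rho h₀ h₁).monotone (Int.lt_succ _).le))).1
  obtain ⟨C', hC'⟩ := exists_seqNorm_mul_tsum_le (W := fun k => V (k + 1)) h₁.exponent_pos hq hγ
    hgrowth
  refine ⟨C' * M.toNNReal, fun F hF => ?_⟩
  have hblock (j : ℤ) :
      logNorm q₁ (Ioc (t j) (t (j + 1))) (fun u => ENNReal.ofReal (b₁ u) * F u) ≤
        M.toNNReal * (tailENorm q₁ b₁ (t (j + 1)) * F (t (j + 1))) := by
    refine (h₁.logNorm_Ioc_mul_le hF (ht.pos _) _).trans_eq ?_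
    rw [ht.tailENorm_one_eq h₁, mul_assoc]
  refine (seqNorm_mono hq fun k => ?_).trans ((hC' fun j => M.toNNReal *
    (tailENorm q₁ b₁ (t (j + 1)) * F (t (j + 1)))).trans ?_)
  · gcongr
    refine (ht.logNorm_Ioi_le h₁.exponent_pos _ k).trans ?_
    have := h₁.exponent_pos
    gcongr
    exact hblock _
  · rw [ENNReal.coe_mul, mul_assoc, ← seqNorm_comp_add q (fun k => ENNReal.ofReal
      (gridWeight q₀ q₁ θ b₀ b₁ b (t k)) * F (t k)) 1]
    gcongr
    refine seqNorm_le_const_mul hq fun k => ?_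
    rw [ofReal_gridWeight_eq_mul_tailENorm h₀ h₁ θ b (ht.pos _), mul_left_comm, mul_assoc]

variable {Ω : Type*} [MeasurableSpace Ω] {μ : Measure Ω}

theorem exists_seqNorm_kFunctional_le (ht : IsGrid q₀ q₁ b₀ b₁ M t) (h₀ : TailWeight q₀ b₀)
    (h₁ : TailWeight q₁ b₁) (hq : 0 < q) (hp : 0 < p) (hr : 0 < r) (hθ₀ : 0 < θ) (hθ₁ : θ < 1)
    (hb : Potter b) (hw : Potter w) : ∃ C : ℝ≥0, ∀ f : Ω →ₘ[μ] ℝ,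
      seqNorm q (fun k => ENNReal.ofReal (ρ (t k) ^ (-θ) * b (ρ (t k))) *
          kFunctional (gammaNorm r q₀ p b₀ w) (gammaNorm r q₁ p b₁ w) (ρ (t k)) f) ≤
        C * seqNorm q fun k =>
          ENNReal.ofReal (gridWeight q₀ q₁ θ b₀ b₁ b (t k)) * innerNorm r p w f (t k) := by
  obtain ⟨C, hC⟩ := exists_kFunctional_rho_le (μ := μ) h₀ h₁ hr hp hw
  obtain ⟨C', hC'⟩ := exists_seqNorm_add_le hq
  obtain ⟨C₀, hC₀⟩ := ht.exists_seqNorm_logNorm_Ioc_zero_le h₀ h₁ hq hθ₀ hb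
  obtain ⟨C₁, hC₁⟩ := ht.exists_seqNorm_logNorm_Ioi_le h₀ h₁ hq hθ₁ hb
  refine ⟨C * C' * (C₀ + C₁), fun f => ?_⟩
  have hF := innerNorm_monotone (p := p) (w := w) hr f
  have hsplit (k : ℤ) : ENNReal.ofReal (ρ (t k) ^ (-θ) * b (ρ (t k))) *
      kFunctional (gammaNorm r q₀ p b₀ w) (gammaNorm r q₁ p b₁ w) (ρ (t k)) f ≤
        C * (ENNReal.ofReal (ρ (t k) ^ (-θ) * b (ρ (t k))) *
            logNorm q₀ (Ioc 0 (t k)) (fun u => ENNReal.ofReal (b₀ u) * innerNorm r p w f u) +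
          ENNReal.ofReal (ρ (t k) ^ (1 - θ) * b (ρ (t k))) *
            logNorm q₁ (Ioi (t k)) fun u => ENNReal.ofReal (b₁ u) * innerNorm r p w f u) := by
    have hρ := rho_pos h₀ h₁ (ht.pos k)
    rw [sub_eq_neg_add, Real.rpow_add hρ, Real.rpow_one, mul_right_comm _ (ρ (t k)),
      ENNReal.ofReal_mul' hρ.le, mul_assoc _ (ENNReal.ofReal (ρ (t k))), ← mul_add,
      mul_left_comm (C : ℝ≥0∞)]
    gcongr
    exact hC f (t k) (ht.pos k)
  refine (seqNorm_le_const_mul hq hsplit).trans ?_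
  rw [ENNReal.coe_mul, ENNReal.coe_mul, ENNReal.coe_add, mul_assoc, mul_assoc, add_mul]
  gcongr
  refine (hC' _ _).trans ?_
  gcongr
  exacts [hC₀ _ hF, hC₁ _ hF]

theorem exists_seqNorm_le_seqNorm_kFunctional (ht : IsGrid q₀ q₁ b₀ b₁ M t)
    (h₀ : TailWeight q₀ b₀) (h₁ : TailWeight q₁ b₁) (hq : 0 < q) (hr : 0 < r) (p θ : ℝ)
    (b : ℝ → ℝ) (hw : IsSV w) : ∃ C : ℝ≥0, ∀ f : Ω →ₘ[μ] ℝ,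
      seqNorm q (fun k =>
          ENNReal.ofReal (gridWeight q₀ q₁ θ b₀ b₁ b (t k)) * innerNorm r p w f (t k)) ≤
        C * seqNorm q fun k => ENNReal.ofReal (ρ (t k) ^ (-θ) * b (ρ (t k))) *
          kFunctional (gammaNorm r q₀ p b₀ w) (gammaNorm r q₁ p b₁ w) (ρ (t k)) f := by
  obtain ⟨C, hC⟩ := exists_tailENorm_mul_le_kFunctional_rho (μ := μ) h₀ h₁ hr p hw
  refine ⟨C, fun f => seqNorm_le_const_mul hq fun k => ?_⟩
  rw [ofReal_gridWeight h₀ θ b (ht.pos k), mul_assoc, mul_left_comm (C : ℝ≥0∞)]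
  exact mul_le_mul_right (hC f (t k) (ht.pos k)) _

end IsGrid

end Grid

/-! ### The weight `b̃` -/

section BTilde

variable {q₀ q₁ q r p θ M : ℝ} {b₀ b₁ b w : ℝ → ℝ} {t : ℤ → ℝ}

local notation "ρ" => rho q₀ q₁ b₀ b₁

theorem bTilde_eq_gridWeight_mul (h₀ : TailWeight q₀ b₀) (h₁ : TailWeight q₁ b₁) (q θ : ℝ)
    (b : ℝ → ℝ) {u : ℝ} (hu : 0 < u) : bTilde q₀ q₁ q θ b₀ b₁ b u =
      gridWeight q₀ q₁ θ b₀ b₁ b u * tailNorm q₁ b₁ u ^ (-(q₁ / q)) * b₁ u ^ (q₁ / q) := by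
  have hA₁ := h₁.tailNorm_pos hu
  rw [bTilde, gridWeight, h₁.integral_Ioi_rpow_div hu, ← Real.rpow_mul hA₁.le, mul_sub,
    mul_one_div_cancel h₁.exponent_pos.ne', mul_one_div, sub_eq_add_neg 1 (q₁ / q),
    Real.rpow_add hA₁, Real.rpow_one, ← rho_mul_tailNorm (q₀ := q₀) (b₀ := b₀) h₁ hu,
    sub_eq_neg_add 1 θ, Real.rpow_add (rho_pos h₀ h₁ hu), Real.rpow_one]
  ring

theorem isSV_bTilde (h₀ : TailWeight q₀ b₀) (h₁ : TailWeight q₁ b₁) (q θ : ℝ) (hb : Potter b)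
    (hbρ : AEMeasurable (fun t => b (ρ t)) (volume.restrict (Ioi 0))) :
    IsSV (bTilde q₀ q₁ q θ b₀ b₁ b) := by
  have hfactor : EqOn (fun u => gridWeight q₀ q₁ θ b₀ b₁ b u * tailNorm q₁ b₁ u ^ (-(q₁ / q)) *
      b₁ u ^ (q₁ / q)) (bTilde q₀ q₁ q θ b₀ b₁ b) (Ioi 0) :=
    fun u hu => (bTilde_eq_gridWeight_mul h₀ h₁ q θ b hu).symm
  have hU : Potter (gridWeight q₀ q₁ θ b₀ b₁ b) :=
    (((potter_rho h₀ h₁).rpow (-θ)).mul (hb.comp (potter_rho h₀ h₁))).mul h₀.potter_tailNorm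
  have hA₀ := h₀.aemeasurable_tailNorm
  have hA₁ := h₁.aemeasurable_tailNorm
  refine isSV_iff_potter.2 ⟨((hU.mul (h₁.potter_tailNorm.rpow _)).mul
    (h₁.potter.rpow _)).congr hfactor, AEMeasurable.congr ?_
      ((ae_restrict_mem measurableSet_Ioi).mono hfactor)⟩
  exact (((((hA₀.div hA₁).pow_const _).mul hbρ).mul hA₀).mul (hA₁.pow_const _)).mul
    (h₁.isSV0.isSV.aemeasurable.pow_const _)

namespace IsGrid

theorem comparable_tailNorm_zero (ht : IsGrid q₀ q₁ b₀ b₁ M t) (h₀ : TailWeight q₀ b₀)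
    (h₁ : TailWeight q₁ b₁) {k : ℤ} {u : ℝ} (hu : u ∈ Icc (t k) (t (k + 1))) :
    Comparable M (tailNorm q₀ b₀ u) (tailNorm q₀ b₀ (t k)) := by
  have hM : 1 ≤ M := one_le_two.trans ht.two_le
  have hu₀ := (ht.pos k).trans_le hu.1
  refine ⟨h₀.tailNorm_pos hu₀, h₀.tailNorm_pos (ht.pos k), ?_,
    (ht.tailNorm_zero_le h₀ h₁ k).trans ?_⟩
  · exact (h₀.tailNorm_anti (ht.pos k) hu.1).trans
      (le_mul_of_one_le_left (h₀.tailNorm_pos (ht.pos k)).le hM)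
  · gcongr
    exact h₀.tailNorm_anti hu₀ hu.2

theorem comparable_tailNorm_one (ht : IsGrid q₀ q₁ b₀ b₁ M t) (h₁ : TailWeight q₁ b₁) {k : ℤ}
    {u : ℝ} (hu : u ∈ Icc (t k) (t (k + 1))) :
    Comparable M (tailNorm q₁ b₁ u) (tailNorm q₁ b₁ (t k)) := by
  have hM : 1 ≤ M := one_le_two.trans ht.two_le
  have hu₀ := (ht.pos k).trans_le hu.1
  refine ⟨h₁.tailNorm_pos hu₀, h₁.tailNorm_pos (ht.pos k), ?_, (ht.tailNorm_eq k).trans_le ?_⟩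
  · exact (h₁.tailNorm_anti (ht.pos k) hu.1).trans
      (le_mul_of_one_le_left (h₁.tailNorm_pos (ht.pos k)).le hM)
  · gcongr
    exact h₁.tailNorm_anti hu₀ hu.2

theorem exists_comparable_gridWeight (ht : IsGrid q₀ q₁ b₀ b₁ M t) (h₀ : TailWeight q₀ b₀)
    (h₁ : TailWeight q₁ b₁) (θ : ℝ) (hb : Doubling b) :
    ∃ C, ∀ (k : ℤ), ∀ u ∈ Icc (t k) (t (k + 1)), Comparable C
      (gridWeight q₀ q₁ θ b₀ b₁ b u) (gridWeight q₀ q₁ θ b₀ b₁ b (t k)) := by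
  obtain ⟨C, hC⟩ := hb.rpow_mul (-θ) (M * M)
  refine ⟨C * M, fun k u hu => ?_⟩
  have hA₀ := ht.comparable_tailNorm_zero h₀ h₁ hu
  refine (hC _ _ ?_).mul hA₀
  simpa only [rho, div_eq_mul_inv] using hA₀.mul (ht.comparable_tailNorm_one h₁ hu).inv

theorem exists_comparable_bTilde (ht : IsGrid q₀ q₁ b₀ b₁ M t) (h₀ : TailWeight q₀ b₀)
    (h₁ : TailWeight q₁ b₁) (q θ : ℝ) (hb : Doubling b) :
    ∃ C, ∀ (k : ℤ), ∀ u ∈ Icc (t k) (t (k + 1)), Comparable C (bTilde q₀ q₁ q θ b₀ b₁ b u)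
      (gridWeight q₀ q₁ θ b₀ b₁ b (t k) * tailNorm q₁ b₁ (t k) ^ (-(q₁ / q)) *
        b₁ u ^ (q₁ / q)) := by
  obtain ⟨C, hC⟩ := ht.exists_comparable_gridWeight h₀ h₁ θ hb
  refine ⟨C * M ^ |-(q₁ / q)| * 1, fun k u hu => ?_⟩
  have hu₀ := (ht.pos k).trans_le hu.1
  rw [bTilde_eq_gridWeight_mul h₀ h₁ q θ b hu₀]
  exact ((hC k u hu).mul ((ht.comparable_tailNorm_one h₁ hu).rpow _)).mul
    (.refl (Real.rpow_pos_of_pos (h₁.potter.pos hu₀) _))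

theorem one_sub_rpow_pos (ht : IsGrid q₀ q₁ b₀ b₁ M t) (hq₁ : 0 < q₁) : 0 < 1 - M ^ (-q₁) :=
  sub_pos.2 (Real.rpow_lt_one_of_one_lt_of_neg (one_lt_two.trans_le ht.two_le) (neg_lt_zero.2 hq₁))

theorem logNorm_Ioc_gridWeight_mul (ht : IsGrid q₀ q₁ b₀ b₁ M t) (h₀ : TailWeight q₀ b₀)
    (h₁ : TailWeight q₁ b₁) (hq : 0 < q) (θ : ℝ) (hb : Potter b) (k : ℤ) :
    logNorm q (Ioc (t k) (t (k + 1))) (fun u => ENNReal.ofReal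
      (gridWeight q₀ q₁ θ b₀ b₁ b (t k) * tailNorm q₁ b₁ (t k) ^ (-(q₁ / q)) *
        b₁ u ^ (q₁ / q))) =
      ENNReal.ofReal ((1 - M ^ (-q₁)) ^ (1 / q)) *
        ENNReal.ofReal (gridWeight q₀ q₁ θ b₀ b₁ b (t k)) := by
  have hM : 0 < M := two_pos.trans_le ht.two_le
  have hmass := ht.one_sub_rpow_pos h₁.exponent_pos
  have hA₁ := h₁.tailNorm_pos (ht.pos k)
  have hU : 0 < gridWeight q₀ q₁ θ b₀ b₁ b (t k) := gridWeight_pos h₀ h₁ θ hb (ht.pos k)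
  have hnext : tailNorm q₁ b₁ (t (k + 1)) = M⁻¹ * tailNorm q₁ b₁ (t k) := by
    rw [ht.tailNorm_eq k, inv_mul_cancel_left₀ hM.ne']
  have hdiff : (tailNorm q₁ b₁ (t k) ^ q₁ - tailNorm q₁ b₁ (t (k + 1)) ^ q₁) ^ (1 / q) =
      (1 - M ^ (-q₁)) ^ (1 / q) * tailNorm q₁ b₁ (t k) ^ (q₁ / q) := by
    rw [hnext, Real.mul_rpow (inv_nonneg.2 hM.le) hA₁.le, Real.inv_rpow hM.le,
      ← Real.rpow_neg hM.le, ← one_sub_mul, Real.mul_rpow hmass.le (Real.rpow_nonneg hA₁.le _),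
      ← Real.rpow_mul hA₁.le, mul_one_div]
  have hE := mul_pos hU (Real.rpow_pos_of_pos hA₁ (-(q₁ / q)))
  simp only [ENNReal.ofReal_mul hE.le]
  rw [logNorm_const_mul hq ENNReal.ofReal_ne_top,
    h₁.logNorm_Ioc_rpow_div hq (ht.pos k) (ht.monotone (Int.lt_succ k).le), hdiff,
    ← ENNReal.ofReal_mul hE.le, ← ENNReal.ofReal_mul (Real.rpow_nonneg hmass.le _)]
  congr 1
  rw [Real.rpow_neg hA₁.le]
  field_simp

theorem exists_logNorm_bTilde_le (ht : IsGrid q₀ q₁ b₀ b₁ M t) (h₀ : TailWeight q₀ b₀)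
    (h₁ : TailWeight q₁ b₁) (hq : 0 < q) (θ : ℝ) (hb : Potter b) : ∃ C : ℝ≥0, 0 < C ∧ ∀ k,
      logNorm q (Ioc (t k) (t (k + 1))) (fun u => ENNReal.ofReal (bTilde q₀ q₁ q θ b₀ b₁ b u)) ≤
        C * ENNReal.ofReal (gridWeight q₀ q₁ θ b₀ b₁ b (t k)) := by
  obtain ⟨C, hC⟩ := ht.exists_comparable_bTilde h₀ h₁ q θ hb.doubling
  have hCpos : 0 < C :=
    (hC 0 (t 0) (left_mem_Icc.2 (ht.monotone (Int.lt_succ 0).le))).const_pos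
  have hmass := Real.rpow_pos_of_pos (ht.one_sub_rpow_pos h₁.exponent_pos) (1 / q)
  refine ⟨C.toNNReal * ((1 - M ^ (-q₁)) ^ (1 / q)).toNNReal,
    mul_pos (Real.toNNReal_pos.2 hCpos) (Real.toNNReal_pos.2 hmass), fun k => ?_⟩
  refine (logNorm_le_of_comparable hq measurableSet_Ioc
    fun u hu => hC k u (Ioc_subset_Icc_self hu)).trans_eq ?_
  rw [ht.logNorm_Ioc_gridWeight_mul h₀ h₁ hq θ hb, ENNReal.coe_mul, mul_assoc, ENNReal.ofReal]

theorem exists_gridWeight_le_logNorm (ht : IsGrid q₀ q₁ b₀ b₁ M t) (h₀ : TailWeight q₀ b₀)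
    (h₁ : TailWeight q₁ b₁) (hq : 0 < q) (θ : ℝ) (hb : Potter b) : ∃ C : ℝ≥0, ∀ k,
      ENNReal.ofReal (gridWeight q₀ q₁ θ b₀ b₁ b (t k)) ≤ C * logNorm q (Ioc (t k) (t (k + 1)))
        fun u => ENNReal.ofReal (bTilde q₀ q₁ q θ b₀ b₁ b u) := by
  obtain ⟨C, hC⟩ := ht.exists_comparable_bTilde h₀ h₁ q θ hb.doubling
  have hmass := Real.rpow_pos_of_pos (ht.one_sub_rpow_pos h₁.exponent_pos) (1 / q)
  set m := ((1 - M ^ (-q₁)) ^ (1 / q)).toNNReal with hm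
  have hm₀ : (m : ℝ≥0∞) ≠ 0 := ENNReal.coe_ne_zero.2 (Real.toNNReal_pos.2 hmass).ne'
  refine ⟨m⁻¹ * C.toNNReal, fun k => ?_⟩
  have hle := logNorm_le_of_comparable hq measurableSet_Ioc
    fun u hu => (hC k u (Ioc_subset_Icc_self hu)).symm
  rw [ht.logNorm_Ioc_gridWeight_mul h₀ h₁ hq θ hb, ENNReal.ofReal, ← hm] at hle
  rw [ENNReal.coe_mul, ENNReal.coe_inv (ENNReal.coe_ne_zero.1 hm₀), mul_assoc,
    ← ENNReal.mul_le_iff_le_inv hm₀ ENNReal.coe_ne_top]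
  exact hle

theorem exists_gridWeight_geometric_le (ht : IsGrid q₀ q₁ b₀ b₁ M t) (h₀ : TailWeight q₀ b₀)
    (h₁ : TailWeight q₁ b₁) (hθ : 0 < θ) (hb : Potter b) : ∃ C γ : ℝ≥0, γ < 1 ∧
      ∀ (k : ℤ) (n : ℕ), gridWeight q₀ q₁ θ b₀ b₁ b (t (k + n)) ≤
        C * γ ^ n * gridWeight q₀ q₁ θ b₀ b₁ b (t k) := by
  obtain ⟨C, γ, hγ, hC⟩ := hb.exists_geometric_le hθ
  refine ⟨C, γ, hγ, fun k n => ?_⟩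
  have hρ := rho_pos h₀ h₁ (ht.pos k)
  have hbρ := hb.pos hρ
  rw [gridWeight, gridWeight, ← mul_assoc]
  exact mul_le_mul (hC n _ _ hρ (ht.two_pow_mul_rho_le k n)).2
    (h₀.tailNorm_anti (ht.pos k) (ht.monotone (le_add_of_nonneg_right n.cast_nonneg)))
    (h₀.tailNorm_pos (ht.pos _)).le (by positivity)

theorem tailENorm_bTilde_lt_top (ht : IsGrid q₀ q₁ b₀ b₁ M t) (h₀ : TailWeight q₀ b₀)
    (h₁ : TailWeight q₁ b₁) (hq : 0 < q) (hθ : 0 < θ) (hb : Potter b) :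
    tailENorm q (bTilde q₀ q₁ q θ b₀ b₁ b) 1 < ∞ := by
  obtain ⟨k, hk⟩ := ht.exists_lt 1 one_pos
  obtain ⟨C, -, hC⟩ := ht.exists_logNorm_bTilde_le h₀ h₁ hq θ hb
  obtain ⟨D, γ, hγ, hD⟩ := ht.exists_gridWeight_geometric_le h₀ h₁ hθ hb
  set c : ℝ≥0∞ := C * D * ENNReal.ofReal (gridWeight q₀ q₁ θ b₀ b₁ b (t k))
  have hterm (n : ℕ) : logNorm q (Ioc (t (k + 1 * n)) (t (k + 1 * n + 1)))
      (fun u => ENNReal.ofReal (bTilde q₀ q₁ q θ b₀ b₁ b u)) ≤ (γ : ℝ≥0∞) ^ n * c := by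
    refine (hC _).trans ?_
    calc (C : ℝ≥0∞) * ENNReal.ofReal (gridWeight q₀ q₁ θ b₀ b₁ b (t (k + 1 * n)))
        ≤ C * ENNReal.ofReal (D * γ ^ n * gridWeight q₀ q₁ θ b₀ b₁ b (t k)) := by
          rw [one_mul]
          gcongr
          exact hD k n
      _ = (γ : ℝ≥0∞) ^ n * c := by
          rw [ENNReal.ofReal_mul (by positivity), ENNReal.ofReal_mul D.coe_nonneg,
            ENNReal.ofReal_pow γ.coe_nonneg, ENNReal.ofReal_coe_nnreal, ENNReal.ofReal_coe_nnreal]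
          ring
  rw [tailENorm_eq_logNorm hq zero_le_one]
  refine (logNorm_mono_set hq (Ioi_subset_Ioi hk.le)).trans_lt ?_
  refine (ht.logNorm_Ioi_le hq _ k).trans_lt (lt_of_le_of_lt ?_
    (ENNReal.mul_lt_top (inv_one_sub_rpow_ne_top hq (ENNReal.coe_lt_one_iff.2 hγ)).lt_top
      (?_ : c < ∞)))
  · rw [← tsum_geometric_mul_const_rpow hq]
    gcongr
    exact hterm _
  · finiteness

variable {Ω : Type*} [MeasurableSpace Ω] {μ : Measure Ω}

theorem exists_seqNorm_le_gammaNorm (ht : IsGrid q₀ q₁ b₀ b₁ M t) (h₀ : TailWeight q₀ b₀)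
    (h₁ : TailWeight q₁ b₁) (hq : 0 < q) (hr : 0 < r) (p θ : ℝ) (hb : Potter b) (w : ℝ → ℝ) :
    ∃ C : ℝ≥0, ∀ f : Ω →ₘ[μ] ℝ,
      seqNorm q (fun k =>
          ENNReal.ofReal (gridWeight q₀ q₁ θ b₀ b₁ b (t k)) * innerNorm r p w f (t k)) ≤
        C * gammaNorm r q p (bTilde q₀ q₁ q θ b₀ b₁ b) w f := by
  obtain ⟨C, hC⟩ := ht.exists_gridWeight_le_logNorm h₀ h₁ hq θ hb
  refine ⟨C, fun f => ?_⟩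
  rw [gammaNorm_eq_logNorm hr hq]
  exact ht.seqNorm_le_logNorm hq (innerNorm_monotone hr f) hC

theorem exists_gammaNorm_le_seqNorm (ht : IsGrid q₀ q₁ b₀ b₁ M t) (h₀ : TailWeight q₀ b₀)
    (h₁ : TailWeight q₁ b₁) (hq : 0 < q) (hr : 0 < r) (p θ : ℝ) (hb : Potter b) (w : ℝ → ℝ) :
    ∃ C : ℝ≥0, ∀ f : Ω →ₘ[μ] ℝ, gammaNorm r q p (bTilde q₀ q₁ q θ b₀ b₁ b) w f ≤
      C * seqNorm q fun k =>
        ENNReal.ofReal (gridWeight q₀ q₁ θ b₀ b₁ b (t k)) * innerNorm r p w f (t k) := by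
  obtain ⟨C, hCpos, hC⟩ := ht.exists_logNorm_bTilde_le h₀ h₁ hq θ hb
  obtain ⟨D, hD⟩ := ht.exists_comparable_gridWeight h₀ h₁ θ hb.doubling
  refine ⟨C * D.toNNReal, fun f => ?_⟩
  rw [gammaNorm_eq_logNorm hr hq, ENNReal.coe_mul, mul_assoc]
  refine (ht.logNorm_le_seqNorm hq (innerNorm_monotone hr f) (ENNReal.coe_ne_zero.2 hCpos.ne')
    (fun k => (ENNReal.ofReal_pos.2 (gridWeight_pos h₀ h₁ θ hb (ht.pos k))).ne') hC).trans ?_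
  rw [← seqNorm_comp_add q (fun k => ENNReal.ofReal (gridWeight q₀ q₁ θ b₀ b₁ b (t k)) *
    innerNorm r p w f (t k)) 1]
  gcongr
  refine seqNorm_le_const_mul hq fun k => ?_
  rw [← mul_assoc]
  gcongr
  exact (hD k _ (right_mem_Icc.2 (ht.monotone (Int.lt_succ k).le))).symm.ofReal_le

theorem exists_interpNorm_le_gammaNorm (ht : IsGrid q₀ q₁ b₀ b₁ M t) (h₀ : TailWeight q₀ b₀)
    (h₁ : TailWeight q₁ b₁) (hq : 0 < q) (hp : 0 < p) (hr : 0 < r) (hθ₀ : 0 < θ) (hθ₁ : θ < 1)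
    (hb : Potter b) (hw : Potter w) : ∃ C : ℝ≥0, ∀ f : Ω →ₘ[μ] ℝ,
      interpNorm (gammaNorm r q₀ p b₀ w) (gammaNorm r q₁ p b₁ w) θ q b f ≤
        C * gammaNorm r q p (bTilde q₀ q₁ q θ b₀ b₁ b) w f := by
  obtain ⟨C₁, hC₁⟩ := exists_interpNorm_le_seqNorm (gammaNorm (μ := μ) r q₀ p b₀ w)
    (gammaNorm r q₁ p b₁ w) θ hq hb.doubling (ht.isPartition_rho h₀ h₁) ht.rho_le_mul
  obtain ⟨C₂, hC₂⟩ := ht.exists_seqNorm_kFunctional_le (μ := μ) h₀ h₁ hq hp hr hθ₀ hθ₁ hb hw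
  obtain ⟨C₃, hC₃⟩ := ht.exists_seqNorm_le_gammaNorm (μ := μ) h₀ h₁ hq hr p θ hb w
  refine ⟨C₁ * (C₂ * C₃), fun f => (hC₁ f).trans ?_⟩
  rw [ENNReal.coe_mul, ENNReal.coe_mul, mul_assoc, mul_assoc]
  gcongr
  exact (hC₂ f).trans (mul_le_mul_right (hC₃ f) _)

theorem exists_gammaNorm_le_interpNorm (ht : IsGrid q₀ q₁ b₀ b₁ M t) (h₀ : TailWeight q₀ b₀)
    (h₁ : TailWeight q₁ b₁) (hq : 0 < q) (hr : 0 < r) (p θ : ℝ) (hb : Potter b) (hw : IsSV w) :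
    ∃ C : ℝ≥0, ∀ f : Ω →ₘ[μ] ℝ, gammaNorm r q p (bTilde q₀ q₁ q θ b₀ b₁ b) w f ≤
      C * interpNorm (gammaNorm r q₀ p b₀ w) (gammaNorm r q₁ p b₁ w) θ q b f := by
  obtain ⟨C₁, hC₁⟩ := ht.exists_gammaNorm_le_seqNorm (μ := μ) h₀ h₁ hq hr p θ hb w
  obtain ⟨C₂, hC₂⟩ := ht.exists_seqNorm_le_seqNorm_kFunctional (μ := μ) h₀ h₁ hq hr p θ b hw
  obtain ⟨C₃, hC₃⟩ := exists_seqNorm_le_interpNorm (gammaNorm (μ := μ) r q₀ p b₀ w)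
    (gammaNorm r q₁ p b₁ w) θ hq hb.doubling (fun k => rho_pos h₀ h₁ (ht.pos k)) ht.two_mul_rho_le
  refine ⟨C₁ * (C₂ * C₃), fun f => (hC₁ f).trans ?_⟩
  rw [ENNReal.coe_mul, ENNReal.coe_mul, mul_assoc, mul_assoc]
  gcongr
  exact (hC₂ f).trans (mul_le_mul_right (hC₃ f) _)

end IsGrid

end BTilde

section NormEquivalence

variable {V : Type*} {N N' : V → ℝ≥0∞}

theorem finiteSet_subset_of_le {C : ℝ≥0} (h : ∀ f, N' f ≤ C * N f) :
    finiteSet N ⊆ finiteSet N' :=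
  fun f hf => (h f).trans_lt (ENNReal.mul_lt_top ENNReal.coe_lt_top hf)

theorem exists_pos_ofReal_mul_le {C D : ℝ≥0} (hC : ∀ f, N f ≤ C * N' f)
    (hD : ∀ f, N' f ≤ D * N f) : ∃ c > (0 : ℝ), ∃ C > (0 : ℝ), ∀ f,
      ENNReal.ofReal c * N' f ≤ N f ∧ N f ≤ ENNReal.ofReal C * N' f := by
  refine ⟨((D + 1)⁻¹ : ℝ≥0), by positivity, (C + 1 : ℝ≥0), by positivity, fun f => ⟨?_, ?_⟩⟩
  · rw [ENNReal.ofReal_coe_nnreal, ENNReal.coe_inv (by positivity), mul_comm, ← div_eq_mul_inv]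
    refine ENNReal.div_le_of_le_mul' ((hD f).trans ?_)
    gcongr
    exact le_self_add
  · rw [ENNReal.ofReal_coe_nnreal]
    refine (hC f).trans ?_
    gcongr
    exact le_self_add

end NormEquivalence

end GenGamma

end

open GenGamma in
theorem mainTheorem11_general {Ω : Type*} [MeasurableSpace Ω] (μ : MeasureTheory.Measure Ω)
    (q₀ q₁ q p r θ : ℝ) (hq₀ : 0 < q₀) (hq₁ : 0 < q₁)
    (hq : 0 < q) (hp : 0 < p) (hr : 0 < r) (hθ₀ : 0 < θ) (hθ₁ : θ < 1)
    (b₀ b₁ b w : ℝ → ℝ)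
    (hb₀ : GenGamma.IsSV0 q₀ b₀) (hb₁ : GenGamma.IsSV0 q₁ b₁)
    (hb : GenGamma.IsSV b) (hw : GenGamma.IsSV w)
    (hcond : GenGamma.RhoCondition q₀ q₁ b₀ b₁)
    (hzero : Filter.Tendsto (GenGamma.rho q₀ q₁ b₀ b₁) (nhdsWithin 0 (Set.Ioi 0)) (nhds 0)) :
    (AEMeasurable (fun t => b (GenGamma.rho q₀ q₁ b₀ b₁ t))
        (MeasureTheory.volume.restrict (Set.Ioi 0)) →
      GenGamma.IsSV0 q (GenGamma.bTilde q₀ q₁ q θ b₀ b₁ b)) ∧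
    GenGamma.interpSpace
        (GenGamma.gammaNorm (μ := μ) r q₀ p b₀ w) (GenGamma.gammaNorm (μ := μ) r q₁ p b₁ w) θ q b
      = GenGamma.gammaSpace μ r q p (GenGamma.bTilde q₀ q₁ q θ b₀ b₁ b) w ∧
    ∃ c > (0 : ℝ), ∃ C > (0 : ℝ), ∀ f : MeasureTheory.AEEqFun Ω ℝ μ,
      ENNReal.ofReal c *
          GenGamma.gammaNorm r q p (GenGamma.bTilde q₀ q₁ q θ b₀ b₁ b) w f
        ≤ GenGamma.interpNorm
            (GenGamma.gammaNorm r q₀ p b₀ w) (GenGamma.gammaNorm r q₁ p b₁ w) θ q b f ∧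
      GenGamma.interpNorm
          (GenGamma.gammaNorm r q₀ p b₀ w) (GenGamma.gammaNorm r q₁ p b₁ w) θ q b f
        ≤ ENNReal.ofReal C *
          GenGamma.gammaNorm r q p (GenGamma.bTilde q₀ q₁ q θ b₀ b₁ b) w f := by
  have h₀ : TailWeight q₀ b₀ := ⟨hq₀, hb₀⟩
  have h₁ : TailWeight q₁ b₁ := ⟨hq₁, hb₁⟩
  obtain ⟨M, t, ht⟩ := hcond.exists_isGrid h₀ h₁ hzero
  obtain ⟨C, hC⟩ := ht.exists_interpNorm_le_gammaNorm (μ := μ) h₀ h₁ hq hp hr hθ₀ hθ₁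
    hb.potter hw.potter
  obtain ⟨D, hD⟩ := ht.exists_gammaNorm_le_interpNorm (μ := μ) h₀ h₁ hq hr p θ hb.potter hw
  refine ⟨fun hbρ => ⟨isSV_bTilde h₀ h₁ q θ hb.potter hbρ,
    ht.tailENorm_bTilde_lt_top h₀ h₁ hq hθ₀ hb.potter⟩, ?_, exists_pos_ofReal_mul_le hC hD⟩
  rw [interpSpace_eq_finiteSet _ _ θ hq hb.potter.doubling]
  exact (finiteSet_subset_of_le hD).antisymm (finiteSet_subset_of_le hC)

theorem mainTheorem11 {Ω : Type*} [MeasurableSpace Ω] (μ : MeasureTheory.Measure Ω)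
    [MeasureTheory.SigmaFinite μ]
    (q₀ q₁ q p r θ : ℝ) (hq₀ : 0 < q₀) (hq₁ : 0 < q₁) (hq₀₁ : q₀ ≠ q₁)
    (hq : 0 < q) (hp : 0 < p) (hr : 0 < r) (hθ₀ : 0 < θ) (hθ₁ : θ < 1)
    (b₀ b₁ b w : ℝ → ℝ)
    (hb₀ : GenGamma.IsSV0 q₀ b₀) (hb₁ : GenGamma.IsSV0 q₁ b₁)
    (hb : GenGamma.IsSV b) (hw : GenGamma.IsSV w)
    (hcond : GenGamma.RhoCondition q₀ q₁ b₀ b₁)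
    (hmono : MonotoneOn (GenGamma.rho q₀ q₁ b₀ b₁) (Set.Ioi 0))
    (hzero : Filter.Tendsto (GenGamma.rho q₀ q₁ b₀ b₁) (nhdsWithin 0 (Set.Ioi 0)) (nhds 0))
    (htop : Filter.Tendsto (GenGamma.rho q₀ q₁ b₀ b₁) Filter.atTop Filter.atTop) :
    -- the weight `b̃` is admissible (as soon as `b ∘ ρ` is Lebesgue measurable)
    (AEMeasurable (fun t => b (GenGamma.rho q₀ q₁ b₀ b₁ t))
        (MeasureTheory.volume.restrict (Set.Ioi 0)) →
      GenGamma.IsSV0 q (GenGamma.bTilde q₀ q₁ q θ b₀ b₁ b)) ∧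
    -- the two spaces consist of the same functions
    GenGamma.interpSpace
        (GenGamma.gammaNorm (μ := μ) r q₀ p b₀ w) (GenGamma.gammaNorm (μ := μ) r q₁ p b₁ w) θ q b
      = GenGamma.gammaSpace μ r q p (GenGamma.bTilde q₀ q₁ q θ b₀ b₁ b) w ∧
    -- and their quasi-norms are equivalent
    ∃ c > (0 : ℝ), ∃ C > (0 : ℝ), ∀ f : MeasureTheory.AEEqFun Ω ℝ μ,
      ENNReal.ofReal c *
          GenGamma.gammaNorm r q p (GenGamma.bTilde q₀ q₁ q θ b₀ b₁ b) w f
        ≤ GenGamma.interpNorm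
            (GenGamma.gammaNorm r q₀ p b₀ w) (GenGamma.gammaNorm r q₁ p b₁ w) θ q b f ∧
      GenGamma.interpNorm
          (GenGamma.gammaNorm r q₀ p b₀ w) (GenGamma.gammaNorm r q₁ p b₁ w) θ q b f
        ≤ ENNReal.ofReal C *
          GenGamma.gammaNorm r q p (GenGamma.bTilde q₀ q₁ q θ b₀ b₁ b) w f :=
  mainTheorem11_general μ q₀ q₁ q p r θ hq₀ hq₁ hq hp hr hθ₀ hθ₁ b₀ b₁ b w hb₀ hb₁ hb hw hcond
    hzero
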